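/- \textbf{Conventions.} Let $G=\langle X\mid R\rangle$ be a finite presentation. A word is an element of the free monoid on $X\sqcup X^{-1}$ and $|w|$ denotes its length. For a word $w$ representing $1\in G$, let $$\mathrm{Area}(w)=\min\Big\{m \;\Big|\; w=\prod_{i=1}^m u_i r_i u_i^{-1} \text{ in } F(X),\ u_i\in F(X),\ r_i\in R^{\pm1}\Big\},$$ and let the Dehn function be $\delta(n)=\max\{\mathrm{Area}(w)\mid |w|\le n,\ w=_G1\}$. For $f,g:\mathbb N\to\mathbb R$ write $f\preccurlyeq g$ if there is a constant $C>0$ with $f(n)\le C\,g(Cn+C)+Cn+C$ for all $n$ (take $C$ to be an integer), and $f\asymp g$ if $f\preccurlyeq g\preccurlyeq f$. A function $f$ is superadditive if $f(m+n)\ge f(m)+f(n)$ for all $m,n>0$; the superadditive closure $\overline f$ is the smallest superadditive function with $\overline f\ge f$. Up to $\asymp$ the Dehn function does not depend on the finite presentation. A homomorphism is virtually surjective if its image has finite index. \textbf{Theorem.} Let $r\ge 3$ and $l\ge 0$ be integers, let $G_1,\dots,G_r$ be finitely presented groups, and let $K=\ker\phi$ for a homomorphism $\phi:G_1\times\dots\times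 G_r\to\mathbb Z^l$ whose restriction to every factor $G_i$ is virtually surjective. Suppose that $\lceil l/2\rceil\le r/4$. Then $K$ is finitely presented. Moreover, let $\delta_K$ be the Dehn function of $K$ with respect to any finite presentation of $K$, and let $f:\mathbb N\to\mathbb R_{\ge0}$ be any non-decreasing function asymptotically equivalent to the Dehn function of $G_1\times\dots\times G_r$ with respect to some finite presentation (for instance, that Dehn function itself). Then $$f(n)\preccurlyeq\delta_K(n)\preccurlyeq \log(n)\cdot\overline f(n).$$ If, moreover, $n\mapsto f(n)/n$ is superadditive, then $\delta_K(n)\asymp f(n)$. -/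

import Mathlib

/-- A finite presentation `⟨x₁, …, xₖ ∣ R⟩` of a group `G`: a surjection from the free group on
`k` letters whose kernel is the normal closure of the finite set `R` of relators. -/
structure FinitePresentation (G : Type*) [Group G] where
  /-- the number of generators -/
  k : ℕ
  /-- the evaluation of words in the group -/
  π : FreeGroup (Fin k) →* G
  /-- the relators -/
  R : Set (FreeGroup (Fin k))
  surjective : Function.Surjective π
  finite_R : R.Finite
  ker_eq : Subgroup.normalClosure R = π.ker

namespace FinitePresentation

variable {G : Type*} [Group G] (P : FinitePresentation G)

/-- Words in the generators and their formal inverses: the letter `(x, true)` stands for `x` and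
`(x, false)` for `x⁻¹`. Words need not be reduced; the length of a word is its list length. -/
abbrev Word : Type := List (Fin P.k × Bool)

/-- The word `w` represents the trivial element of the group. -/
def IsNullHomotopic (w : P.Word) : Prop := P.π (FreeGroup.mk w) = 1

/-- The word `w` equals, in the free group, a product of `m` conjugates `u * r * u⁻¹` of
relators and inverses of relators. -/
def HasFilling (w : P.Word) (m : ℕ) : Prop :=
  ∃ L : List (FreeGroup (Fin P.k) × FreeGroup (Fin P.k)), L.length = m ∧
    (∀ c ∈ L, c.2 ∈ P.R ∨ c.2⁻¹ ∈ P.R) ∧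
    FreeGroup.mk w = (L.map fun c => c.1 * c.2 * c.1⁻¹).prod

/-- The area of a null-homotopic word. -/
noncomputable def area (w : P.Word) : ℕ := sInf {m | P.HasFilling w m}

/-- The Dehn function: the maximal area of a null-homotopic word of length at most `n`. -/
noncomputable def dehn (n : ℕ) : ℕ :=
  sSup {a | ∃ w : P.Word, w.length ≤ n ∧ P.IsNullHomotopic w ∧ P.area w = a}

/-- The minimum in the definition of the area is over a nonempty set. -/
theorem exists_hasFilling {w : P.Word} (hw : P.IsNullHomotopic w) : ∃ m, P.HasFilling w m := by
  have key : ∀ g ∈ Subgroup.normalClosure P.R,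
      ∃ L : List (FreeGroup (Fin P.k) × FreeGroup (Fin P.k)),
        (∀ c ∈ L, c.2 ∈ P.R ∨ c.2⁻¹ ∈ P.R) ∧ g = (L.map fun c => c.1 * c.2 * c.1⁻¹).prod := by
    intro g hg
    induction hg using Subgroup.closure_induction with
    | mem x hx =>
      obtain ⟨r, hr, hc⟩ := Group.mem_conjugatesOfSet_iff.1 hx
      obtain ⟨u, hu⟩ := isConj_iff.1 hc
      exact ⟨[(u, r)], by simpa using Or.inl hr, by simpa using hu.symm⟩
    | one => exact ⟨[], by simp, by simp⟩
    | mul x y _ _ hx hy =>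
      obtain ⟨L, hL, rfl⟩ := hx
      obtain ⟨M, hM, rfl⟩ := hy
      refine ⟨L ++ M, fun c hc => ?_, by simp⟩
      rcases List.mem_append.1 hc with h | h
      · exact hL c h
      · exact hM c h
    | inv x _ hx =>
      obtain ⟨L, hL, rfl⟩ := hx
      refine ⟨(L.map fun c => (c.1, c.2⁻¹)).reverse, ?_, ?_⟩
      · intro c hc
        simp only [List.mem_reverse, List.mem_map] at hc
        obtain ⟨d, hd, rfl⟩ := hc
        simpa using (hL d hd).symm
      · rw [List.prod_inv_reverse, List.map_reverse, List.map_map, List.map_map]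
        congr 3
        funext c
        simp [mul_assoc]
  obtain ⟨L, hL, h⟩ := key (FreeGroup.mk w) (by rw [P.ker_eq]; exact hw)
  exact ⟨L.length, L, rfl, hL, h⟩

/-- The maximum in the definition of the Dehn function is over a nonempty bounded set, hence is
attained. -/
theorem isGreatest_dehn (n : ℕ) :
    IsGreatest {a | ∃ w : P.Word, w.length ≤ n ∧ P.IsNullHomotopic w ∧ P.area w = a}
      (P.dehn n) := by
  have hfin : {a | ∃ w : P.Word, w.length ≤ n ∧ P.IsNullHomotopic w ∧ P.area w = a}.Finite := by
    refine ((List.finite_length_le (Fin P.k × Bool) n).image P.area).subset ?_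
    rintro a ⟨w, hw, -, rfl⟩
    exact ⟨w, hw, rfl⟩
  have hne : {a | ∃ w : P.Word, w.length ≤ n ∧ P.IsNullHomotopic w ∧ P.area w = a}.Nonempty :=
    ⟨_, [], by simp, by simp [IsNullHomotopic, ← FreeGroup.one_eq_mk], rfl⟩
  exact ⟨Nat.sSup_mem hne hfin.bddAbove, fun a ha => le_csSup hfin.bddAbove ha⟩

/-- Presentations of this kind exist exactly for the finitely presented groups. -/
theorem nonempty_iff (G : Type*) [Group G] :
    Nonempty (FinitePresentation G) ↔ Group.IsFinitelyPresented G :=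
  ⟨fun ⟨P⟩ => ⟨P.k, P.π, P.surjective, P.R, P.finite_R, P.ker_eq⟩,
    fun ⟨k, π, h, R, hR, e⟩ => ⟨⟨k, π, R, h, hR, e⟩⟩⟩

end FinitePresentation

/-- `f ≼ g`: there is a constant `C > 0` with `f(n) ≤ C g(Cn + C) + Cn + C` for all `n`. -/
def AsympLE (f g : ℕ → ℝ) : Prop :=
  ∃ C : ℕ, 0 < C ∧ ∀ n : ℕ, f n ≤ C * g (C * n + C) + C * n + C

/-- `f ≍ g`: asymptotic equivalence. -/
def AsympEq (f g : ℕ → ℝ) : Prop := AsympLE f g ∧ AsympLE g f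

/-- Superadditivity, as a condition on the values at positive integers. -/
def Superadditive (f : ℕ → ℝ) : Prop :=
  ∀ m n : ℕ, 0 < m → 0 < n → f m + f n ≤ f (m + n)

/-- The superadditive closure: the smallest superadditive function bounded below by `f`. -/
noncomputable def superadditiveClosure (f : ℕ → ℝ) (n : ℕ) : ℝ :=
  sInf {y | ∃ g : ℕ → ℝ, Superadditive g ∧ f ≤ g ∧ g n = y}

theorem superadditiveClosure_isLeast (f : ℕ → ℝ) :
    IsLeast {g : ℕ → ℝ | Superadditive g ∧ f ≤ g} (superadditiveClosure f) := by
  have hbdd : ∀ n, BddBelow {y | ∃ g : ℕ → ℝ, Superadditive g ∧ f ≤ g ∧ g n = y} := by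
    intro n
    refine ⟨f n, ?_⟩
    rintro y ⟨g, -, hg, rfl⟩
    exact hg n
  have hne : ∀ n, {y | ∃ g : ℕ → ℝ, Superadditive g ∧ f ≤ g ∧ g n = y}.Nonempty := by
    intro n
    let F : ℕ → ℝ := fun n => ∑ i ∈ Finset.range (n + 1), |f i|
    have hF0 : ∀ n, 0 ≤ F n := fun n => Finset.sum_nonneg fun i _ => abs_nonneg _
    have hFm : Monotone F := fun a b hab =>
      Finset.sum_le_sum_of_subset_of_nonneg (by simpa using hab) fun i _ _ => abs_nonneg _
    have hfF : ∀ n, f n ≤ F n := fun n => (le_abs_self _).trans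
      (Finset.single_le_sum (f := fun i => |f i|) (fun i _ => abs_nonneg _)
        (Finset.mem_range.2 n.lt_succ_self))
    refine ⟨_, fun n => if n = 0 then f 0 else n * F n, ?_, ?_, rfl⟩
    · intro a b ha hb
      have h1 : F a ≤ F (a + b) := hFm (by omega)
      have h2 : F b ≤ F (a + b) := hFm (by omega)
      have hab : a + b ≠ 0 := by omega
      simp only [ha.ne', hb.ne', hab, if_false]
      push_cast
      nlinarith [mul_le_mul_of_nonneg_left h1 (Nat.cast_nonneg (α := ℝ) a),
        mul_le_mul_of_nonneg_left h2 (Nat.cast_nonneg (α := ℝ) b)]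
    · intro k
      rcases Nat.eq_zero_or_pos k with rfl | hk
      · simp
      · have h1 : (1 : ℝ) ≤ k := by exact_mod_cast hk
        simp only [hk.ne', if_false]
        nlinarith [hF0 k, hfF k]
  refine ⟨⟨?_, ?_⟩, ?_⟩
  · intro a b ha hb
    refine le_csInf (hne _) ?_
    rintro y ⟨g, hg, hfg, rfl⟩
    exact (add_le_add (csInf_le (hbdd a) ⟨g, hg, hfg, rfl⟩)
      (csInf_le (hbdd b) ⟨g, hg, hfg, rfl⟩)).trans (hg a b ha hb)
  · intro n
    refine le_csInf (hne n) ?_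
    rintro y ⟨g, -, hfg, rfl⟩
    exact hfg n
  · rintro g ⟨hg, hfg⟩ n
    exact csInf_le (hbdd n) ⟨g, hg, hfg, rfl⟩

/-! Upper bound. Passing to subgroups of finite index does not change Dehn functions up to
equivalence. So G may be taken to be a product of four blocks A_b, and Z^l = L_true × L_false splits
into halves of rank at most m = ⌈l/2⌉. A block contains at least m of the original factors, hence
carries a homomorphic section of each half: distinct coordinates of one half sit in distinct factors
and commute. The two sections of a block need not commute with each other, but each is killed by the
other half. Therefore two blocks embed homomorphically in K, the values of the two halves being
cancelled by sections in the other two blocks, one half in each (`SplitSystem.pair`). With P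
embedding blocks 0, 1 and P' embedding blocks 2, 3, every x in K has the normal form P(x) ·
P'(P(x)⁻¹x).

The core is that triangles of normal forms have area controlled by the Dehn function M of G. A
homomorphism G → K carries fillings in G to fillings in K at bounded cost. Hence words obtained from
homomorphisms G → K can be treated as elements of an honest group: families of words of K modulo
families of small area (`exists_familyRep`). There the problem becomes algebra. Comparing different
placements of the sections shows that elements of K supported in complementary pairs of blocks
commute (`FamilyRep.Θ_pair_commute`), and the normal form is multiplicative
(`FamilyRep.normalForm_mul`).

A word of length n is then cut dyadically into such triangles (`fillsIn_dyadic`). Each of about log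
n levels costs at most the superadditive closure; if f(n)/n is superadditive, the levels decay
geometrically.

Lower bound. A_0 × A_1 and A_2 × A_3 are retracts of K, and G is their product. Filling in a product
costs the fillings in the factors plus a quadratic sorting term. That term is harmless because K
contains two commuting elements independent in its abelianization, so its Dehn function is at least
quadratic (`DehnLE.sq_le`, via the Heisenberg group). -/

/-- `g` is a product of at most `m` conjugates of elements of `R` and of their inverses. -/
def FillsIn {F : Type*} [Group F] (R : Set F) (m : ℕ) (g : F) : Prop :=
  ∃ L : List (F × F), L.length ≤ m ∧ (∀ c ∈ L, c.2 ∈ R ∨ c.2⁻¹ ∈ R) ∧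
    g = (L.map fun c => c.1 * c.2 * c.1⁻¹).prod

/-! ### Calculus of fillings -/

namespace FillsIn

variable {F F' : Type*} [Group F] [Group F'] {R S : Set F} {m n : ℕ} {g h : F}

theorem one : FillsIn R m (1 : F) := ⟨[], by simp, by simp, by simp⟩

theorem mono (H : FillsIn R m g) (hRS : R ⊆ S) (hmn : m ≤ n) : FillsIn S n g := by
  obtain ⟨L, hl, hL, e⟩ := H
  exact ⟨L, hl.trans hmn, fun c hc => (hL c hc).imp (fun h => hRS h) (fun h => hRS h), e⟩

theorem of_mem (h : g ∈ R) : FillsIn R 1 g :=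
  ⟨[(1, g)], by simp, by simpa using Or.inl h, by simp⟩

theorem mul (hg : FillsIn R m g) (hh : FillsIn R n h) : FillsIn R (m + n) (g * h) := by
  obtain ⟨L, hl, hL, rfl⟩ := hg
  obtain ⟨M, hm, hM, rfl⟩ := hh
  refine ⟨L ++ M, by simp; omega, fun c hc => ?_, by simp⟩
  rcases List.mem_append.1 hc with h | h
  · exact hL c h
  · exact hM c h

theorem inv (hg : FillsIn R m g) : FillsIn R m g⁻¹ := by
  obtain ⟨L, hl, hL, rfl⟩ := hg
  refine ⟨(L.map fun c => (c.1, c.2⁻¹)).reverse, by simpa, ?_, ?_⟩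
  · intro c hc
    simp only [List.mem_reverse, List.mem_map] at hc
    obtain ⟨d, hd, rfl⟩ := hc
    simpa using (hL d hd).symm
  · rw [List.prod_inv_reverse, List.map_reverse, List.map_map, List.map_map]
    congr 3
    funext c
    simp [mul_assoc]

theorem conj (hg : FillsIn R m g) (u : F) : FillsIn R m (u * g * u⁻¹) := by
  obtain ⟨L, hl, hL, rfl⟩ := hg
  refine ⟨L.map fun c => (u * c.1, c.2), by simpa, ?_, ?_⟩
  · intro c hc
    obtain ⟨d, hd, rfl⟩ := List.mem_map.1 hc
    exact hL d hd
  · clear hl hL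
    induction L with
    | nil => simp
    | cons c L ih =>
      simp only [List.map_cons, List.prod_cons, List.map_map] at ih ⊢
      rw [← ih]
      group

/-- Induction along a filling. -/
theorem induct {P : ℕ → F → Prop} (one : ∀ m, P m 1)
    (cons : ∀ m u r g, (r ∈ R ∨ r⁻¹ ∈ R) → P m g → P (m + 1) (u * r * u⁻¹ * g))
    (H : FillsIn R m g) : P m g := by
  obtain ⟨L, hl, hL, rfl⟩ := H
  induction L generalizing m with
  | nil => simpa using one m
  | cons c L ih =>
    obtain ⟨m, rfl⟩ : ∃ k, m = k + 1 := ⟨m - 1, by simp at hl; omega⟩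
    simp only [List.map_cons, List.prod_cons]
    exact cons m c.1 c.2 _ (hL c (by simp)) (ih (by simpa using hl) fun d hd => hL d (by simp [hd]))

/-- Relators that can be filled by other relators may be replaced by them. -/
theorem trans {c : ℕ} (H : FillsIn R m g) (hR : ∀ r ∈ R, FillsIn S c r) : FillsIn S (m * c) g := by
  refine H.induct (P := fun m g => FillsIn S (m * c) g) (fun _ => one) fun m u r g hr hg => ?_
  have : FillsIn S c r := hr.elim (hR r) fun h => by simpa using (hR _ h).inv
  exact ((this.conj u).mul hg).mono le_rfl (by rw [Nat.succ_mul, add_comm])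

theorem map (f : F →* F') {S : Set F'} (H : FillsIn R m g) (hR : ∀ r ∈ R, f r ∈ S) :
    FillsIn S m (f g) := by
  refine H.induct (P := fun m g => FillsIn S m (f g)) (fun _ => by simpa using one)
    fun m u r g hr hg => ?_
  have : FillsIn S 1 (f r) := hr.elim (fun h => of_mem (hR r h)) fun h => by
    simpa using (of_mem (hR _ h)).inv
  simpa [add_comm] using (this.conj (f u)).mul hg

/-- Composition of two fillings of differences. -/
theorem div_trans {a b c : F} (h₁ : FillsIn R m (a * b⁻¹)) (h₂ : FillsIn R n (b * c⁻¹)) :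
    FillsIn R (m + n) (a * c⁻¹) := by
  simpa [mul_assoc] using h₁.mul h₂

theorem div_mul {a b c d : F} (h₁ : FillsIn R m (a * b⁻¹)) (h₂ : FillsIn R n (c * d⁻¹)) :
    FillsIn R (m + n) ((a * c) * (b * d)⁻¹) := by
  have := (h₂.conj a).mul h₁
  rw [add_comm]
  simpa [mul_assoc] using this

end FillsIn

namespace FreeGroup

theorem induct_mk {α : Type*} {P : ℕ → FreeGroup α → Prop} (one : P 0 1)
    (of : ∀ s n u, P n u → P (n + 1) (of s * u))
    (inv : ∀ s n u, P n u → P (n + 1) ((FreeGroup.of s)⁻¹ * u)) (L : List (α × Bool)) :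
    P L.length (mk L) := by
  induction L with
  | nil => exact one
  | cons c L ih =>
    obtain ⟨s, b⟩ := c
    cases b
    · exact inv s _ _ ih
    · exact of s _ _ ih

theorem induct_norm {α : Type*} [DecidableEq α] {P : ℕ → FreeGroup α → Prop} (one : P 0 1)
    (of : ∀ s n u, P n u → P (n + 1) (of s * u))
    (inv : ∀ s n u, P n u → P (n + 1) ((FreeGroup.of s)⁻¹ * u)) (u : FreeGroup α) :
    P u.norm u := by
  simpa [norm, mk_toWord] using induct_mk one of inv u.toWord

theorem finite_norm_le {α : Type*} [DecidableEq α] [Finite α] (n : ℕ) :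
    {u : FreeGroup α | u.norm ≤ n}.Finite := by
  refine ((List.finite_length_le (α × Bool) n).image mk).subset fun u hu => ?_
  exact ⟨u.toWord, hu, mk_toWord⟩

theorem norm_pow_le {α : Type*} [DecidableEq α] (u : FreeGroup α) (n : ℕ) :
    (u ^ n).norm ≤ n * u.norm := by
  induction n with
  | zero => simp
  | succ n ih =>
    have := norm_mul_le (u ^ n) u
    rw [pow_succ, Nat.succ_mul]
    omega

end FreeGroup

/-! ### Cocycles and coarse maps -/

/-- A function on a free group that is multiplicative up to translation of the base point along the
homomorphism `π`. -/
structure IsCocycle {α Γ F : Type*} [Group Γ] [Group F] (π : FreeGroup α →* Γ)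
    (Λ : Γ → FreeGroup α → F) : Prop where
  map_mul : ∀ g u v, Λ g (u * v) = Λ g u * Λ (g * π u) v

namespace IsCocycle

variable {α Γ F : Type*} [Group Γ] [Group F] {π : FreeGroup α →* Γ} {Λ : Γ → FreeGroup α → F}

theorem map_one (h : IsCocycle π Λ) (g : Γ) : Λ g 1 = 1 := by
  simpa using h.map_mul g 1 1

theorem map_inv (h : IsCocycle π Λ) (g : Γ) (u : FreeGroup α) :
    Λ g u⁻¹ = (Λ (g * (π u)⁻¹) u)⁻¹ := by
  have := h.map_mul g u⁻¹ u
  rw [inv_mul_cancel, h.map_one, _root_.map_inv] at this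
  exact eq_inv_of_mul_eq_one_left this.symm

theorem map_conj (h : IsCocycle π Λ) (g : Γ) (u r : FreeGroup α) (hr : π r = 1) :
    Λ g (u * r * u⁻¹) = Λ g u * Λ (g * π u) r * (Λ g u)⁻¹ := by
  rw [h.map_mul, h.map_mul, h.map_inv]
  simp [hr]

theorem norm_le {β : Type*} [DecidableEq α] [DecidableEq β] {Λ : Γ → FreeGroup α → FreeGroup β}
    (h : IsCocycle π Λ) {C : ℕ} (hC : ∀ g s, (Λ g (FreeGroup.of s)).norm ≤ C) (g : Γ)
    (u : FreeGroup α) : (Λ g u).norm ≤ C * u.norm := by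
  refine FreeGroup.induct_norm (P := fun n u => ∀ g, (Λ g u).norm ≤ C * n) ?_ ?_ ?_ u g
  · simp [h.map_one]
  · intro s n u ih g
    rw [h.map_mul, mul_add, mul_one, add_comm]
    exact (FreeGroup.norm_mul_le _ _).trans (Nat.add_le_add (hC _ _) (ih _))
  · intro s n u ih g
    rw [h.map_mul, mul_add, mul_one, add_comm, h.map_inv]
    refine (FreeGroup.norm_mul_le _ _).trans (Nat.add_le_add ?_ (ih _))
    rw [FreeGroup.norm_inv_eq]
    exact hC _ _

/-- The free group acts on `Γ × F` from the right, a letter `s` moving `(g, x)` to `(g * π s, x *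
lam g s)`; `Λ g u` is the second coordinate of `(g, 1)` moved by `u`. The opposite group turns
composition of permutations into a right action. -/
theorem exists_of (π : FreeGroup α →* Γ) (lam : Γ → α → F) :
    ∃ Λ : Γ → FreeGroup α → F, IsCocycle π Λ ∧ ∀ g s, Λ g (FreeGroup.of s) = lam g s := by
  let T : α → Equiv.Perm (Γ × F) := fun s =>
    { toFun := fun p => (p.1 * π (FreeGroup.of s), p.2 * lam p.1 s)
      invFun := fun p => (p.1 * (π (FreeGroup.of s))⁻¹,
        p.2 * (lam (p.1 * (π (FreeGroup.of s))⁻¹) s)⁻¹)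
      left_inv := fun p => by simp
      right_inv := fun p => by simp }
  let Φ : FreeGroup α →* (Equiv.Perm (Γ × F))ᵐᵒᵖ := FreeGroup.lift fun s => MulOpposite.op (T s)
  -- The action commutes with left multiplication on `F`, which is what makes the second coordinate
  -- a cocycle.
  have key : ∀ u g x, (Φ u).unop (g, x) = (g * π u, x * ((Φ u).unop (g, 1)).2) := by
    intro u
    induction u using FreeGroup.induction_on with
    | C1 => simp
    | of s => simp [Φ, T]
    | inv_of s _ => simp [Φ, T, Equiv.Perm.inv_def]
    | mul u v hu hv =>
      intro g x
      simp only [_root_.map_mul, MulOpposite.unop_mul, Equiv.Perm.mul_apply]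
      rw [hu g x, hv, hu g 1, hv _ (1 * _)]
      simp [mul_assoc]
  refine ⟨fun g u => ((Φ u).unop (g, 1)).2, ⟨fun g u v => ?_⟩, fun g s => by simp [Φ, T]⟩
  simp only [_root_.map_mul, MulOpposite.unop_mul, Equiv.Perm.mul_apply]
  rw [key u g 1, key v]

end IsCocycle

/-- A map between groups that moves points at bounded distance to points at bounded distance. -/
def IsCoarse {Γ H : Type*} [Group Γ] [Group H] (f : Γ → H) : Prop :=
  ∀ a, (Set.range fun g => (f g)⁻¹ * f (g * a)).Finite

theorem MonoidHom.isCoarse {Γ H : Type*} [Group Γ] [Group H] (f : Γ →* H) : IsCoarse f := by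
  intro a
  refine (Set.finite_singleton (f a)).subset ?_
  rintro _ ⟨g, rfl⟩
  simp

/-- A path in the Cayley graph of `Γ` is pushed along `f` letter by letter. Only finitely many
displacements `(f g)⁻¹ * f (g * s)` occur, so fixed words for them have bounded length. -/
theorem IsCoarse.exists_cocycle {k k' : ℕ} {Γ H : Type*} [Group Γ] [Group H] {f : Γ → H}
    (hf : IsCoarse f) (π : FreeGroup (Fin k) →* Γ) {π' : FreeGroup (Fin k') →* H}
    (hπ' : Function.Surjective π') :
    ∃ C, ∃ Λ : Γ → FreeGroup (Fin k) → FreeGroup (Fin k'), IsCocycle π Λ ∧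
      (∀ g u, π' (Λ g u) = (f g)⁻¹ * f (g * π u)) ∧ ∀ g u, (Λ g u).norm ≤ C * u.norm := by
  choose w hw using hπ'
  obtain ⟨Λ, hΛ, hof⟩ := IsCocycle.exists_of π fun g s =>
    w ((f g)⁻¹ * f (g * π (FreeGroup.of s)))
  have hfin : (⋃ s, w '' Set.range fun g => (f g)⁻¹ * f (g * π (FreeGroup.of s))).Finite :=
    Set.finite_iUnion fun s => (hf _).image w
  obtain ⟨C, hC⟩ := (hfin.image FreeGroup.norm).bddAbove
  refine ⟨C, Λ, hΛ, ?_, hΛ.norm_le fun g s => ?_⟩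
  · intro g u
    induction u using FreeGroup.induction_on generalizing g with
    | C1 => simp [hΛ.map_one]
    | of s => rw [hof, hw]
    | inv_of s _ => rw [hΛ.map_inv, hof, map_inv, hw]; simp
    | mul u v hu hv => rw [hΛ.map_mul, map_mul, hu, hv, map_mul]; simp [mul_assoc]
  · rw [hof]
    exact hC ⟨_, Set.mem_iUnion.2 ⟨s, _, ⟨g, rfl⟩, rfl⟩, rfl⟩

/-! ### Dehn bounds and their invariance under coarse retracts -/

/-- The relators of length at most `C`. -/
def relBall {k : ℕ} {Γ : Type*} [Group Γ] (π : FreeGroup (Fin k) →* Γ) (C : ℕ) :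
    Set (FreeGroup (Fin k)) := {x | π x = 1 ∧ x.norm ≤ C}

theorem relBall_mono {k : ℕ} {Γ : Type*} [Group Γ] (π : FreeGroup (Fin k) →* Γ) {C D : ℕ}
    (h : C ≤ D) : relBall π C ⊆ relBall π D := fun _ hx => ⟨hx.1, hx.2.trans h⟩

/-- The bounds that occur in the definition of `AsympLE`. -/
def affineUp (M : ℕ → ℕ) (C n : ℕ) : ℕ := C * M (C * n + C) + C * n + C

theorem affineUp_mono {M : ℕ → ℕ} (hM : Monotone M) {C D m n : ℕ} (hC : C ≤ D) (hn : m ≤ n) :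
    affineUp M C m ≤ affineUp M D n := by
  have h1 : C * m + C ≤ D * n + D := Nat.add_le_add (Nat.mul_le_mul hC hn) hC
  have h2 := Nat.mul_le_mul hC (hM h1)
  have h3 := Nat.mul_le_mul hC hn
  unfold affineUp
  omega

/-- Collects a linear change of the argument and a linear change of the value into a single
constant, as needed at the end of each area estimate. -/
theorem affineUp_absorb {M : ℕ → ℕ} (hM : Monotone M) (C a : ℕ) :
    ∃ D, a ≤ D ∧ C ≤ D ∧ ∀ n, a * affineUp M C (a * n + a) + a * n + a ≤ affineUp M D n := by
  refine ⟨a * C * a + a * C + C + a, by omega, by omega, fun n => ?_⟩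
  set D := a * C * a + a * C + C + a with hD
  have h1 : C * (a * n + a) + C ≤ D * n + D := by
    have : C * (a * n + a) + C = a * C * n + a * C + C := by ring
    have h : a * C * n ≤ D * n := Nat.mul_le_mul_right _ (by omega)
    omega
  have h2 : a * C * M (C * (a * n + a) + C) ≤ D * M (D * n + D) :=
    Nat.mul_le_mul (by omega) (hM h1)
  have h3 : (a * C * a + a) * n ≤ D * n := Nat.mul_le_mul_right _ (by omega)
  unfold affineUp
  calc a * (C * M (C * (a * n + a) + C) + C * (a * n + a) + C) + a * n + a
      = a * C * M (C * (a * n + a) + C) + (a * C * a + a) * n + (a * C * a + a * C + a) := by ring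
    _ ≤ D * M (D * n + D) + D * n + D := by omega

theorem affineUp_add {M : ℕ → ℕ} (hM : Monotone M) (C D n : ℕ) :
    affineUp M C n + affineUp M D n ≤ affineUp M (C + D) n := by
  have h1 : M (C * n + C) ≤ M ((C + D) * n + (C + D)) := hM (by
    have := Nat.mul_le_mul_right n (Nat.le_add_right C D); omega)
  have h2 : M (D * n + D) ≤ M ((C + D) * n + (C + D)) := hM (by
    have := Nat.mul_le_mul_right n (Nat.le_add_left D C); omega)
  have h3 := Nat.mul_le_mul_left C h1
  have h4 := Nat.mul_le_mul_left D h2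
  unfold affineUp
  rw [add_mul C D, add_mul C D] at *
  omega

/-- Every relation of length `n` among the generators is a consequence of a number of relations of
bounded length that is asymptotically at most `M n`. -/
def IsDehnBound {k : ℕ} {Γ : Type*} [Group Γ] (π : FreeGroup (Fin k) →* Γ) (M : ℕ → ℕ) : Prop :=
  ∃ C, ∀ g, π g = 1 → FillsIn (relBall π C) (affineUp M C g.norm) g

/-- The group is finitely presented, with Dehn function asymptotically at most `M`. -/
def DehnLE (Γ : Type*) [Group Γ] (M : ℕ → ℕ) : Prop :=
  ∃ k, ∃ π : FreeGroup (Fin k) →* Γ, Function.Surjective π ∧ IsDehnBound π M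

theorem Group.FG.exists_surjective (Γ : Type*) [Group Γ] [Group.FG Γ] :
    ∃ k, ∃ π : FreeGroup (Fin k) →* Γ, Function.Surjective π := by
  obtain ⟨α, _, φ, hφ⟩ := Group.fg_iff_exists_freeGroup_hom_surjective_finite.1 ‹Group.FG Γ›
  obtain ⟨k, ⟨e⟩⟩ := Finite.exists_equiv_fin α
  exact ⟨k, φ.comp (FreeGroup.freeGroupCongr e.symm).toMonoidHom,
    hφ.comp (FreeGroup.freeGroupCongr e.symm).surjective⟩

theorem DehnLE.fg {Γ : Type*} [Group Γ] {M : ℕ → ℕ} (h : DehnLE Γ M) : Group.FG Γ := by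
  obtain ⟨k, π, hπ, -⟩ := h
  exact Group.fg_of_surjective hπ

/-- Finite sets of group elements are represented by words of bounded length. -/
theorem exists_words {k : ℕ} {Γ : Type*} [Group Γ] {π : FreeGroup (Fin k) →* Γ}
    (hπ : Function.Surjective π) :
    ∃ w : Γ → FreeGroup (Fin k), (∀ g, π (w g) = g) ∧ (∀ u, (w (π u)).norm ≤ u.norm) ∧
      ∀ X : Set Γ, X.Finite → ∃ C, ∀ g ∈ X, (w g).norm ≤ C := by
  have : ∀ g, ∃ u, π u = g ∧ ∀ v, π v = g → u.norm ≤ v.norm := by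
    intro g
    obtain ⟨u, hu, hmin⟩ := (measure (FreeGroup.norm (α := Fin k))).wf.has_min
      {u | π u = g} (hπ g)
    exact ⟨u, hu, fun v hv => not_lt.1 (hmin v hv)⟩
  choose w hw hmin using this
  refine ⟨w, hw, fun u => hmin _ u rfl, fun X hX => ?_⟩
  obtain ⟨C, hC⟩ := (hX.image fun g => (w g).norm).bddAbove
  exact ⟨C, fun g hg => hC ⟨g, hg, rfl⟩⟩

/-- A path from `1` to `ι h` is carried by `ρ` to a path with steps in a finite set, from `ρ 1` to a
point at bounded displacement from `h`. -/
theorem Group.FG.of_coarse {Γ H : Type*} [Group Γ] [Group H] [Group.FG Γ] {ι : H → Γ} {ρ : Γ → H}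
    (hρ : IsCoarse ρ) (hfin : (Set.range fun h => h⁻¹ * ρ (ι h)).Finite) : Group.FG H := by
  obtain ⟨k, π, hπ⟩ := Group.FG.exists_surjective Γ
  let S : Set H := (⋃ s, Set.range fun g => (ρ g)⁻¹ * ρ (g * π (FreeGroup.of s))) ∪
    (Set.range fun h => h⁻¹ * ρ (ι h)) ∪ {ρ 1}
  have key : ∀ u g, (ρ g)⁻¹ * ρ (g * π u) ∈ Subgroup.closure S := by
    intro u
    have hof : ∀ g s, (ρ g)⁻¹ * ρ (g * π (FreeGroup.of s)) ∈ Subgroup.closure S := fun g s =>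
      Subgroup.subset_closure (Or.inl (Or.inl (Set.mem_iUnion.2 ⟨s, g, rfl⟩)))
    induction u using FreeGroup.induction_on with
    | C1 => simp [one_mem]
    | of s => exact fun g => hof g s
    | inv_of s _ =>
      intro g
      simpa using inv_mem (hof (g * π (FreeGroup.of s)⁻¹) s)
    | mul u v hu hv =>
      intro g
      simpa [mul_assoc] using mul_mem (hu g) (hv (g * π u))
  refine Group.fg_iff.2 ⟨S, ?_, ((Set.finite_iUnion fun s => hρ _).union hfin).union
    (Set.finite_singleton _)⟩
  refine eq_top_iff.2 fun h _ => ?_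
  obtain ⟨u, hu⟩ := hπ (ι h)
  have h1 : h⁻¹ * ρ (ι h) ∈ Subgroup.closure S :=
    Subgroup.subset_closure (Or.inl (Or.inr ⟨h, rfl⟩))
  have h2 : ρ 1 ∈ Subgroup.closure S := Subgroup.subset_closure (Or.inr rfl)
  have h3 := key u 1
  rw [one_mul, hu] at h3
  simpa using mul_mem (mul_mem h2 h3) (inv_mem h1)

/-- Dehn functions do not increase under passage to coarse retracts. -/
theorem IsDehnBound.of_coarse {k k' : ℕ} {Γ H : Type*} [Group Γ] [Group H]
    {π : FreeGroup (Fin k) →* Γ} {π' : FreeGroup (Fin k') →* H} {M : ℕ → ℕ} (h : IsDehnBound π M)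
    (hM : Monotone M) (hπ : Function.Surjective π) (hπ' : Function.Surjective π')
    {ι : H → Γ} {ρ : Γ → H} (hι : IsCoarse ι) (hρ : IsCoarse ρ)
    (hfin : (Set.range fun h => h⁻¹ * ρ (ι h)).Finite) : IsDehnBound π' M := by
  obtain ⟨C₀, hC₀⟩ := h
  obtain ⟨Cι, Λι, hΛι, hΛι', hCι⟩ := hι.exists_cocycle π' hπ
  obtain ⟨Cρ, Λρ, hΛρ, hΛρ', hCρ⟩ := hρ.exists_cocycle π hπ'
  obtain ⟨w, hw, -, hwC⟩ := exists_words hπ'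
  obtain ⟨Cκ, hCκ⟩ := hwC _ hfin
  let κ : H → FreeGroup (Fin k') := fun h => w (h⁻¹ * ρ (ι h))
  have hκ : ∀ h, π' (κ h) = h⁻¹ * ρ (ι h) := fun h => hw _
  have hκC : ∀ h, (κ h).norm ≤ Cκ := fun h => hCκ _ ⟨h, rfl⟩
  -- `C₁` bounds two kinds of relators: the quadrilaterals of `letter`, and the images under `Λρ` of
  -- the relators of length at most `C₀`.
  let C₁ := Cκ + 1 + Cκ + Cρ * Cι + Cρ * C₀
  -- `κ h` is a short path from `h` to `ρ (ι h)`. A letter, its image under `ρ ∘ ι` and the two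
  -- connecting paths bound a relator of bounded length.
  have letter : ∀ h x, x.norm ≤ 1 → FillsIn (relBall π' C₁) 1
      ((κ h)⁻¹ * x * κ (h * π' x) * (Λρ (ι h) (Λι h x))⁻¹) := by
    refine fun h x hx => FillsIn.of_mem ⟨?_, ?_⟩
    · simp [hκ, hΛρ', hΛι', mul_assoc]
    · have h1 := FreeGroup.norm_mul_le ((κ h)⁻¹ * x * κ (h * π' x)) (Λρ (ι h) (Λι h x))⁻¹
      have h2 := FreeGroup.norm_mul_le ((κ h)⁻¹ * x) (κ (h * π' x))
      have h3 := FreeGroup.norm_mul_le (κ h)⁻¹ x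
      rw [FreeGroup.norm_inv_eq] at h1 h3
      have h4 := hκC h
      have h5 := hκC (h * π' x)
      have h6 := (hCρ (ι h) (Λι h x)).trans (Nat.mul_le_mul_left Cρ
        ((hCι h x).trans (Nat.mul_le_mul_left Cι hx)))
      have h7 : Cρ * (Cι * 1) = Cρ * Cι := by ring
      omega
  have step : ∀ x u n h, x.norm ≤ 1 → (∀ h, FillsIn (relBall π' C₁) n
      ((κ h)⁻¹ * u * κ (h * π' u) * (Λρ (ι h) (Λι h u))⁻¹)) → FillsIn (relBall π' C₁) (n + 1)
      ((κ h)⁻¹ * (x * u) * κ (h * π' (x * u)) * (Λρ (ι h) (Λι h (x * u)))⁻¹) := by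
    intro x u n h hx ih
    have h1 := (letter h x hx).div_mul (ih (h * π' x))
    rw [hΛι.map_mul, hΛρ.map_mul, hΛι', add_comm]
    simpa [mul_assoc] using h1
  have ladder : ∀ u h, FillsIn (relBall π' C₁) u.norm
      ((κ h)⁻¹ * u * κ (h * π' u) * (Λρ (ι h) (Λι h u))⁻¹) := by
    intro u
    refine FreeGroup.induct_norm (P := fun n u => ∀ h, FillsIn (relBall π' C₁) n
      ((κ h)⁻¹ * u * κ (h * π' u) * (Λρ (ι h) (Λι h u))⁻¹)) ?_ ?_ ?_ u
    · intro h
      simpa [hΛι.map_one, hΛρ.map_one] using FillsIn.one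
    · exact fun s n u ih h => step _ u n h (by simp) ih
    · exact fun s n u ih h => step _ u n h (by simp) ih
  obtain ⟨D, hD, -, hD'⟩ := affineUp_absorb hM C₀ (C₁ + Cι + 1)
  refine ⟨D, fun u hu => ?_⟩
  have hv : π (Λι 1 u) = 1 := by simp [hΛι', hu]
  -- `Λρ` is not a homomorphism, but relators are loops, so it takes conjugates of relators to
  -- conjugates of their images, whatever the base point.
  have h1 : ∀ g, FillsIn (relBall π' C₁) (affineUp M C₀ (Λι 1 u).norm) (Λρ g (Λι 1 u)) := by
    refine ((hC₀ _ hv).induct (P := fun m v => π v = 1 ∧ ∀ g, FillsIn (relBall π' C₁) m (Λρ g v))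
      ?_ ?_).2
    · exact fun m => ⟨map_one π, fun g => by rw [hΛρ.map_one]; exact FillsIn.one⟩
    · rintro m v r g hr ⟨hg, ih⟩
      have hr1 : π r = 1 ∧ r.norm ≤ C₀ := hr.elim id fun h => ⟨by simpa using h.1, by
        simpa using h.2⟩
      refine ⟨by simp [hr1.1, hg], fun x => ?_⟩
      rw [hΛρ.map_mul, hΛρ.map_conj _ _ _ hr1.1, add_comm]
      have h0 : FillsIn (relBall π' C₁) 1 (Λρ (x * π v) r) := by
        refine FillsIn.of_mem ⟨by simp [hΛρ', hr1.1], ?_⟩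
        have := (hCρ (x * π v) r).trans (Nat.mul_le_mul_left Cρ hr1.2)
        omega
      exact (h0.conj _).mul (ih _)
  have h2 := ((ladder u 1).mul (h1 (ι 1))).conj (κ 1)
  have h3 : κ 1 * ((κ 1)⁻¹ * u * κ (1 * π' u) * (Λρ (ι 1) (Λι 1 u))⁻¹ * Λρ (ι 1) (Λι 1 u)) *
      (κ 1)⁻¹ = u := by simp [hu, mul_assoc]
  rw [h3] at h2
  refine h2.mono (relBall_mono _ (by omega)) (le_trans ?_ (hD' u.norm))
  have h4 : affineUp M C₀ (Λι 1 u).norm ≤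
      affineUp M C₀ ((C₁ + Cι + 1) * u.norm + (C₁ + Cι + 1)) :=
    affineUp_mono hM le_rfl ((hCι 1 u).trans (by
      have := Nat.mul_le_mul_right u.norm (show Cι ≤ C₁ + Cι + 1 by omega)
      omega))
  have h5 := Nat.le_mul_of_pos_left (affineUp M C₀ ((C₁ + Cι + 1) * u.norm + (C₁ + Cι + 1)))
    (show 0 < C₁ + Cι + 1 by omega)
  have h6 := Nat.le_mul_of_pos_left u.norm (show 0 < C₁ + Cι + 1 by omega)
  omega

theorem DehnLE.of_coarse {Γ H : Type*} [Group Γ] [Group H] {M : ℕ → ℕ} (h : DehnLE Γ M)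
    (hM : Monotone M) {ι : H → Γ} {ρ : Γ → H} (hι : IsCoarse ι) (hρ : IsCoarse ρ)
    (hfin : (Set.range fun h => h⁻¹ * ρ (ι h)).Finite) : DehnLE H M := by
  have := h.fg
  have : Group.FG H := Group.FG.of_coarse hρ hfin
  obtain ⟨k', π', hπ'⟩ := Group.FG.exists_surjective H
  obtain ⟨k, π, hπ, hb⟩ := h
  exact ⟨k', π', hπ', hb.of_coarse hM hπ hπ' hι hρ hfin⟩

theorem DehnLE.of_retract {Γ H : Type*} [Group Γ] [Group H] {M : ℕ → ℕ} (h : DehnLE Γ M)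
    (hM : Monotone M) (ι : H →* Γ) (ρ : Γ →* H) (hid : ∀ h, ρ (ι h) = h) : DehnLE H M :=
  h.of_coarse hM ι.isCoarse ρ.isCoarse ((Set.finite_singleton 1).subset (by
    rintro _ ⟨x, rfl⟩; simp [hid]))

/-- Independence of the generators: the identity map is a coarse retraction between two generating
systems of the same group. -/
theorem DehnLE.isDehnBound {Γ : Type*} [Group Γ] {M : ℕ → ℕ} (h : DehnLE Γ M) (hM : Monotone M)
    {k : ℕ} {π : FreeGroup (Fin k) →* Γ} (hπ : Function.Surjective π) : IsDehnBound π M := by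
  obtain ⟨k', π', hπ', hb⟩ := h
  refine hb.of_coarse hM hπ' hπ (MonoidHom.id Γ).isCoarse (MonoidHom.id Γ).isCoarse
    ((Set.finite_singleton 1).subset ?_)
  rintro _ ⟨x, rfl⟩
  simp

/-- A subgroup of finite index is a coarse retract. -/
theorem exists_coarse_of_finiteIndex {Γ H : Type*} [Group Γ] [Group H] {j : H →* Γ}
    (hj : Function.Injective j) (hfi : j.range.FiniteIndex) :
    ∃ c : Γ → H, IsCoarse c ∧ (Set.range fun g => g⁻¹ * j (c g)).Finite ∧
      (Set.range fun h => h⁻¹ * c (j h)).Finite := by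
  -- `x g` represents the coset of `g⁻¹`, so `g * x g` lies in the subgroup; `c g` is its preimage.
  -- Only finitely many `x g` occur.
  let x : Γ → Γ := fun g => (QuotientGroup.mk g⁻¹ : Γ ⧸ j.range).out
  have hx : (Set.range x).Finite :=
    (Set.finite_range fun q : Γ ⧸ j.range => q.out).subset (by
      rintro _ ⟨g, rfl⟩; exact ⟨_, rfl⟩)
  have hc : ∀ g, ∃ h, j h = g * x g := fun g => by
    have h1 : (QuotientGroup.mk g⁻¹ : Γ ⧸ j.range) = QuotientGroup.mk (x g) :=
      (QuotientGroup.out_eq' _).symm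
    simpa using QuotientGroup.eq.1 h1
  choose c hc using hc
  refine ⟨c, fun a => ?_, ?_, ?_⟩
  · refine ((Set.Finite.image2 (fun y z => y⁻¹ * a * z) hx hx).preimage
      (f := j) hj.injOn).subset ?_
    rintro _ ⟨g, rfl⟩
    exact ⟨x g, ⟨g, rfl⟩, x (g * a), ⟨_, rfl⟩, by simp [hc, mul_assoc]⟩
  · refine hx.subset ?_
    rintro _ ⟨g, rfl⟩
    exact ⟨g, by simp [hc]⟩
  · refine (hx.preimage (f := j) hj.injOn).subset ?_
    rintro _ ⟨g, rfl⟩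
    exact ⟨j g, by simp [hc]⟩

theorem dehnLE_iff_of_finiteIndex {Γ H : Type*} [Group Γ] [Group H] {j : H →* Γ}
    (hj : Function.Injective j) (hfi : j.range.FiniteIndex) {M : ℕ → ℕ} (hM : Monotone M) :
    DehnLE H M ↔ DehnLE Γ M := by
  obtain ⟨c, hc, h1, h2⟩ := exists_coarse_of_finiteIndex hj hfi
  exact ⟨fun h => h.of_coarse hM hc j.isCoarse h1, fun h => h.of_coarse hM j.isCoarse hc h2⟩

namespace FinitePresentation

variable {Γ : Type*} [Group Γ] (P : FinitePresentation Γ)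

theorem dehn_mono : Monotone P.dehn := by
  intro m n h
  obtain ⟨w, hw, h0, hA⟩ := (P.isGreatest_dehn m).1
  exact (P.isGreatest_dehn n).2 ⟨w, hw.trans h, h0, hA⟩

theorem π_eq_one {r : FreeGroup (Fin P.k)} (hr : r ∈ P.R) : P.π r = 1 := by
  rw [← MonoidHom.mem_ker, ← P.ker_eq]
  exact Subgroup.subset_normalClosure hr

theorem dehnLE : DehnLE Γ P.dehn := by
  refine ⟨P.k, P.π, P.surjective, ?_⟩
  obtain ⟨C, hC⟩ := (P.finite_R.image FreeGroup.norm).bddAbove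
  refine ⟨C + 1, fun g hg => ?_⟩
  have hw : P.IsNullHomotopic g.toWord := by
    rw [IsNullHomotopic, FreeGroup.mk_toWord]; exact hg
  obtain ⟨L, hL, hR, e⟩ : P.HasFilling g.toWord (P.area g.toWord) :=
    Nat.sInf_mem (P.exists_hasFilling hw)
  rw [FreeGroup.mk_toWord] at e
  have hA : P.area g.toWord ≤ P.dehn g.norm := (P.isGreatest_dehn _).2 ⟨_, le_rfl, hw, rfl⟩
  have h1 : FillsIn P.R (P.dehn g.norm) g := ⟨L, hL.trans_le hA, hR, e⟩
  refine h1.mono (fun r hr => ⟨P.π_eq_one hr, (hC ⟨r, hr, rfl⟩).trans (by omega)⟩) ?_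
  have h2 : P.dehn g.norm ≤ P.dehn ((C + 1) * g.norm + (C + 1)) := P.dehn_mono (by nlinarith)
  have h3 := Nat.le_mul_of_pos_left (P.dehn ((C + 1) * g.norm + (C + 1))) (show 0 < C + 1 by omega)
  unfold affineUp
  omega

theorem area_le {w : P.Word} {m : ℕ} (h : FillsIn P.R m (FreeGroup.mk w)) : P.area w ≤ m := by
  obtain ⟨L, hL, hR, e⟩ := h
  exact le_trans (Nat.sInf_le ⟨L, rfl, hR, e⟩) hL

end FinitePresentation

theorem relBall_finite {k : ℕ} {Γ : Type*} [Group Γ] (π : FreeGroup (Fin k) →* Γ) (C : ℕ) :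
    (relBall π C).Finite :=
  (FreeGroup.finite_norm_le C).subset fun _ hx => hx.2

theorem DehnLE.isFinitelyPresented {Γ : Type*} [Group Γ] {M : ℕ → ℕ} (h : DehnLE Γ M) :
    Group.IsFinitelyPresented Γ := by
  obtain ⟨k, π, hπ, C, hC⟩ := h
  refine (FinitePresentation.nonempty_iff Γ).1 ⟨⟨k, π, relBall π C, hπ, relBall_finite π C, ?_⟩⟩
  refine le_antisymm (Subgroup.normalClosure_le_normal fun x hx => hx.1) fun g hg => ?_
  refine (hC g hg).induct (P := fun _ g => g ∈ Subgroup.normalClosure (relBall π C))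
    (fun _ => one_mem _) fun m u r g hr hg => mul_mem ?_ hg
  refine Subgroup.normalClosure_normal.conj_mem _ ?_ _
  exact hr.elim (fun h => Subgroup.subset_normalClosure h)
    fun h => inv_mem_iff.1 (Subgroup.subset_normalClosure h)

/-- Each of the finitely many relators of length at most `C` has some area over `Q.R`; the maximum
of these areas enters only as a factor. -/
theorem DehnLE.asympLE {Γ : Type*} [Group Γ] {M : ℕ → ℕ} (h : DehnLE Γ M) (hM : Monotone M)
    (Q : FinitePresentation Γ) : AsympLE (fun n => (Q.dehn n : ℝ)) (fun n => (M n : ℝ)) := by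
  obtain ⟨C, hC⟩ := h.isDehnBound hM Q.surjective
  have h1 : ∀ r ∈ relBall Q.π C, ∃ m, FillsIn Q.R m r := by
    intro r hr
    have hw : Q.IsNullHomotopic r.toWord := by
      rw [FinitePresentation.IsNullHomotopic, FreeGroup.mk_toWord]; exact hr.1
    obtain ⟨m, L, hL, hR, e⟩ := Q.exists_hasFilling hw
    rw [FreeGroup.mk_toWord] at e
    exact ⟨m, L, hL.le, hR, e⟩
  choose! m hm using h1
  obtain ⟨c, hc⟩ := ((relBall_finite Q.π C).image m).bddAbove
  obtain ⟨D, hD, -, hD'⟩ := affineUp_absorb hM C (c + 1)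
  refine ⟨D, by omega, fun n => ?_⟩
  obtain ⟨w, hw, h0, hA⟩ := (Q.isGreatest_dehn n).1
  have h2 := (hC _ h0).trans (c := c) fun r hr => (hm r hr).mono le_rfl (hc ⟨r, hr, rfl⟩)
  have h3 := Q.area_le h2
  have h4 : affineUp M C (FreeGroup.mk w).norm ≤ affineUp M C ((c + 1) * n + (c + 1)) :=
    affineUp_mono hM le_rfl ((FreeGroup.norm_mk_le.trans hw).trans (by nlinarith))
  have h5 : Q.dehn n ≤ affineUp M D n := by
    refine le_trans ?_ (hD' n)
    rw [← hA]
    have := Nat.mul_le_mul h4 (Nat.le_succ c)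
    rw [mul_comm _ (c + 1)] at this
    omega
  have h6 : (Q.dehn n : ℝ) ≤ (affineUp M D n : ℝ) := by exact_mod_cast h5
  simpa [affineUp] using h6

/-! ### Quadratic lower bound from the Heisenberg group -/

/-- The integral Heisenberg group. -/
@[ext] structure Heis where
  /-- the first coordinate of the abelianization -/
  x : ℤ
  /-- the second coordinate of the abelianization -/
  y : ℤ
  /-- the central coordinate -/
  z : ℤ

namespace Heis

instance : Mul Heis := ⟨fun g h => ⟨g.x + h.x, g.y + h.y, g.z + h.z + g.x * h.y⟩⟩
instance : One Heis := ⟨⟨0, 0, 0⟩⟩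
instance : Inv Heis := ⟨fun g => ⟨-g.x, -g.y, -g.z + g.x * g.y⟩⟩

@[simp] theorem mul_x (g h : Heis) : (g * h).x = g.x + h.x := rfl
@[simp] theorem mul_y (g h : Heis) : (g * h).y = g.y + h.y := rfl
@[simp] theorem mul_z (g h : Heis) : (g * h).z = g.z + h.z + g.x * h.y := rfl
@[simp] theorem one_x : (1 : Heis).x = 0 := rfl
@[simp] theorem one_y : (1 : Heis).y = 0 := rfl
@[simp] theorem one_z : (1 : Heis).z = 0 := rfl
@[simp] theorem inv_x (g : Heis) : (g⁻¹).x = -g.x := rfl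
@[simp] theorem inv_y (g : Heis) : (g⁻¹).y = -g.y := rfl
@[simp] theorem inv_z (g : Heis) : (g⁻¹).z = -g.z + g.x * g.y := rfl

instance : Group Heis :=
  Group.ofLeftAxioms (fun a b c => by ext <;> simp <;> ring) (fun a => by ext <;> simp)
    (fun a => by ext <;> simp)

theorem pow_x (g : Heis) (n : ℕ) : (g ^ n).x = n * g.x := by
  induction n with
  | zero => simp
  | succ n ih => rw [pow_succ, mul_x, ih]; push_cast; ring

theorem pow_y (g : Heis) (n : ℕ) : (g ^ n).y = n * g.y := by
  induction n with
  | zero => simp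
  | succ n ih => rw [pow_succ, mul_y, ih]; push_cast; ring

/-- The homomorphism to the first coordinate. -/
def fst : Heis →* Multiplicative ℤ where
  toFun g := Multiplicative.ofAdd g.x
  map_one' := rfl
  map_mul' _ _ := rfl

/-- The homomorphism to the second coordinate. -/
def snd : Heis →* Multiplicative ℤ where
  toFun g := Multiplicative.ofAdd g.y
  map_one' := rfl
  map_mul' _ _ := rfl

end Heis

/-- A group with two commuting elements that are independent in its abelianization has at least
quadratic Dehn function. -/
theorem DehnLE.sq_le {Γ : Type*} [Group Γ] {M : ℕ → ℕ} (h : DehnLE Γ M) (hM : Monotone M)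
    (ψ₁ ψ₂ : Γ →* Multiplicative ℤ) {a b : Γ} (hab : Commute a b)
    (h₁a : ψ₁ a = Multiplicative.ofAdd 1) (h₁b : ψ₁ b = 1) (h₂a : ψ₂ a = 1)
    (h₂b : ψ₂ b = Multiplicative.ofAdd 1) : ∃ C, ∀ n, n ^ 2 ≤ affineUp M C n := by
  obtain ⟨k, π, hπ, C₀, hC₀⟩ := h
  -- `Φ` lifts `(ψ₁, ψ₂)` from the abelianization to the Heisenberg group. Relators land in its
  -- centre, where conjugation has no effect, so the central coordinate counts relators up to the
  -- factor `B`.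
  let Φ : FreeGroup (Fin k) →* Heis := FreeGroup.lift fun s =>
    ⟨(ψ₁ (π (FreeGroup.of s))).toAdd, (ψ₂ (π (FreeGroup.of s))).toAdd, 0⟩
  have hΦ₁ : ∀ u, (Φ u).x = (ψ₁ (π u)).toAdd := by
    have : Heis.fst.comp Φ = ψ₁.comp π := FreeGroup.ext_hom _ _ fun s => by simp [Φ, Heis.fst]
    exact fun u => congrArg Multiplicative.toAdd (DFunLike.congr_fun this u)
  have hΦ₂ : ∀ u, (Φ u).y = (ψ₂ (π u)).toAdd := by
    have : Heis.snd.comp Φ = ψ₂.comp π := FreeGroup.ext_hom _ _ fun s => by simp [Φ, Heis.snd]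
    exact fun u => congrArg Multiplicative.toAdd (DFunLike.congr_fun this u)
  obtain ⟨B, hB⟩ := ((relBall_finite π C₀).image fun r => (Φ r).z.natAbs).bddAbove
  have fill : ∀ m g, FillsIn (relBall π C₀) m g →
      (Φ g).x = 0 ∧ (Φ g).y = 0 ∧ (Φ g).z.natAbs ≤ m * B := by
    intro m g hg
    refine hg.induct (P := fun m g => (Φ g).x = 0 ∧ (Φ g).y = 0 ∧ (Φ g).z.natAbs ≤ m * B)
      (by simp) fun m u r g hr hg => ?_
    have hr' : (Φ r).x = 0 ∧ (Φ r).y = 0 ∧ (Φ r).z.natAbs ≤ B := by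
      rcases hr with h | h
      · exact ⟨by simp [hΦ₁, h.1], by simp [hΦ₂, h.1], hB ⟨r, h, rfl⟩⟩
      · have hr1 : π r = 1 := by simpa using h.1
        have hx : (Φ r).x = 0 := by simp [hΦ₁, hr1]
        refine ⟨hx, by simp [hΦ₂, hr1], ?_⟩
        have h2 := hB ⟨_, h, rfl⟩
        simpa [hx] using h2
    obtain ⟨h1, h2, h3⟩ := hr'
    obtain ⟨h4, h5, h6⟩ := hg
    refine ⟨by simp [h1, h4], by simp [h2, h5], ?_⟩
    have : (Φ (u * r * u⁻¹ * g)).z = (Φ r).z + (Φ g).z := by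
      simp [h1, h2, h5]
      ring
    rw [this, Nat.succ_mul]
    omega
  obtain ⟨A, hA⟩ := hπ a
  obtain ⟨A', hA'⟩ := hπ b
  obtain ⟨D, -, -, hD⟩ := affineUp_absorb hM C₀ (B + 2 * (A.norm + A'.norm))
  refine ⟨D, fun n => le_trans ?_ (hD n)⟩
  -- This commutator has length linear in `n`, but central coordinate `n ^ 2`.
  let u := A ^ n * A' ^ n * (A ^ n)⁻¹ * (A' ^ n)⁻¹
  have hu : π u = 1 := by
    simp only [u, map_mul, map_inv, map_pow, hA, hA']
    rw [(hab.pow_pow n n).eq]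
    group
  have hz : (Φ u).z = n ^ 2 := by
    have e1 : (Φ A).x = 1 := by rw [hΦ₁, hA, h₁a]; rfl
    have e2 : (Φ A).y = 0 := by rw [hΦ₂, hA, h₂a]; rfl
    have e3 : (Φ A').x = 0 := by rw [hΦ₁, hA', h₁b]; rfl
    have e4 : (Φ A').y = 1 := by rw [hΦ₂, hA', h₂b]; rfl
    simp [u, Heis.pow_x, Heis.pow_y, e1, e2, e3, e4]
    ring
  have hnorm : u.norm ≤ (B + 2 * (A.norm + A'.norm)) * n + (B + 2 * (A.norm + A'.norm)) := by
    have h1 := FreeGroup.norm_mul_le (A ^ n * A' ^ n * (A ^ n)⁻¹) (A' ^ n)⁻¹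
    have h2 := FreeGroup.norm_mul_le (A ^ n * A' ^ n) (A ^ n)⁻¹
    have h3 := FreeGroup.norm_mul_le (A ^ n) (A' ^ n)
    have h4 := FreeGroup.norm_pow_le A n
    have h5 := FreeGroup.norm_pow_le A' n
    rw [FreeGroup.norm_inv_eq] at h1 h2
    have h6 : (B + 2 * (A.norm + A'.norm)) * n =
      B * n + 2 * (n * A.norm) + 2 * (n * A'.norm) := by ring
    simp only [u]
    omega
  have h1 := (fill _ _ (hC₀ u hu)).2.2
  rw [hz] at h1
  have h2 : n ^ 2 ≤ affineUp M C₀ u.norm * B := by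
    simpa [Int.natAbs_pow] using h1
  have h3 := Nat.mul_le_mul (affineUp_mono (C := C₀) hM le_rfl hnorm)
    (Nat.le_add_right B (2 * (A.norm + A'.norm)))
  rw [mul_comm _ (B + _)] at h3
  omega

/-! ### Dehn functions of direct products -/

theorem DehnLE.mono {Γ : Type*} [Group Γ] {M M' : ℕ → ℕ} (h : DehnLE Γ M) (hMM' : M ≤ M') :
    DehnLE Γ M' := by
  obtain ⟨k, π, hπ, C, hC⟩ := h
  refine ⟨k, π, hπ, C, fun g hg => (hC g hg).mono le_rfl ?_⟩
  have := Nat.mul_le_mul_left C (hMM' (C * g.norm + C))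
  unfold affineUp
  omega

theorem FreeGroup.hom_norm_le {k k' : ℕ} (f : FreeGroup (Fin k) →* FreeGroup (Fin k')) :
    ∃ C, ∀ u, (f u).norm ≤ C * u.norm := by
  obtain ⟨C, hC⟩ := (Set.finite_range fun s => (f (FreeGroup.of s)).norm).bddAbove
  have h : IsCocycle (1 : FreeGroup (Fin k) →* Unit) fun _ u => f u := ⟨fun _ u v => _root_.map_mul f u v⟩
  exact ⟨C, fun u => h.norm_le (fun _ s => hC ⟨s, rfl⟩) () u⟩

/-- Homomorphisms lift to the free groups. -/
theorem exists_lift {k k' : ℕ} {Γ H : Type*} [Group Γ] [Group H] (π : FreeGroup (Fin k) →* Γ)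
    {π' : FreeGroup (Fin k') →* H} (hπ' : Function.Surjective π') (θ : Γ →* H) :
    ∃ f : FreeGroup (Fin k) →* FreeGroup (Fin k'), ∀ u, π' (f u) = θ (π u) := by
  choose w hw using hπ'
  let f := FreeGroup.lift fun s => w (θ (π (FreeGroup.of s)))
  have : π'.comp f = θ.comp π := FreeGroup.ext_hom _ _ fun s => by simp [f, hw]
  exact ⟨f, fun u => DFunLike.congr_fun this u⟩

/-- Two lifts of a homomorphism differ by linearly many relators. -/
theorem fillsIn_lift_div {k k' C : ℕ} {H : Type*} [Group H] (π' : FreeGroup (Fin k') →* H)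
    (f g : FreeGroup (Fin k) →* FreeGroup (Fin k')) (hfg : ∀ u, π' (f u) = π' (g u))
    (hC : ∀ s, (f (FreeGroup.of s)).norm + (g (FreeGroup.of s)).norm ≤ C)
    (u : FreeGroup (Fin k)) : FillsIn (relBall π' C) u.norm (f u * (g u)⁻¹) := by
  refine FreeGroup.induct_norm (P := fun n u => FillsIn (relBall π' C) n (f u * (g u)⁻¹))
    (by simpa using FillsIn.one) ?_ ?_ u
  · intro s n u ih
    have h : FillsIn (relBall π' C) 1 (f (FreeGroup.of s) * (g (FreeGroup.of s))⁻¹) := by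
      refine FillsIn.of_mem ⟨by simp [hfg], (FreeGroup.norm_mul_le _ _).trans ?_⟩
      simpa using hC s
    rw [map_mul, map_mul, add_comm]
    exact h.div_mul ih
  · intro s n u ih
    have h : FillsIn (relBall π' C) 1 (f (FreeGroup.of s)⁻¹ * (g (FreeGroup.of s)⁻¹)⁻¹) := by
      refine FillsIn.of_mem ⟨by simp [hfg], (FreeGroup.norm_mul_le _ _).trans ?_⟩
      simpa using hC s
    rw [map_mul, map_mul, add_comm]
    exact h.div_mul ih

theorem exists_fillsIn_lift_div {k k' : ℕ} {H : Type*} [Group H] (π' : FreeGroup (Fin k') →* H)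
    (f g : FreeGroup (Fin k) →* FreeGroup (Fin k')) (hfg : ∀ u, π' (f u) = π' (g u)) :
    ∃ C, ∀ u, FillsIn (relBall π' C) u.norm (f u * (g u)⁻¹) := by
  obtain ⟨C, hC⟩ := (Set.finite_range fun s =>
    (f (FreeGroup.of s)).norm + (g (FreeGroup.of s)).norm).bddAbove
  exact ⟨C, fillsIn_lift_div π' f g hfg fun s => hC ⟨s, rfl⟩⟩

/-- Images of relators under an endomorphism are filled through any group that the endomorphism
factors through. -/
theorem DehnLE.fillsIn_lift {k : ℕ} {Γ K : Type*} [Group Γ] [Group K] {M : ℕ → ℕ}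
    (h : DehnLE K M) (hM : Monotone M) {π : FreeGroup (Fin k) →* Γ} (hπ : Function.Surjective π)
    {p : Γ →* Γ} (θ : Γ →* K) (κ : K →* Γ) (hp : ∀ x, κ (θ x) = p x)
    {f : FreeGroup (Fin k) →* FreeGroup (Fin k)} (hf : ∀ u, π (f u) = p (π u)) :
    ∃ C, ∀ u, π u = 1 → FillsIn (relBall π C) (affineUp M C u.norm) (f u) := by
  obtain ⟨k', π', hπ', C₀, hC₀⟩ := h
  obtain ⟨θ', hθ'⟩ := exists_lift π hπ' θ
  obtain ⟨κ', hκ'⟩ := exists_lift π' hπ κ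
  obtain ⟨Cθ, hCθ⟩ := FreeGroup.hom_norm_le θ'
  obtain ⟨Cκ, hCκ⟩ := FreeGroup.hom_norm_le κ'
  obtain ⟨C₁, hC₁⟩ := exists_fillsIn_lift_div π f (κ'.comp θ') (by simp [hf, hκ', hθ', hp])
  obtain ⟨D, hD, -, hD'⟩ := affineUp_absorb hM C₀ (C₁ + Cθ + Cκ * C₀ + 1)
  refine ⟨D, fun u hu => ?_⟩
  have h1 := (hC₀ (θ' u) (by simp [hθ', hu])).map κ' (S := relBall π (Cκ * C₀)) fun r hr =>
    ⟨by simp [hκ', hr.1], (hCκ r).trans (Nat.mul_le_mul_left _ hr.2)⟩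
  have h2 := ((hC₁ u).mono (relBall_mono π (show C₁ ≤ D by omega)) le_rfl).mul
    (h1.mono (relBall_mono π (show Cκ * C₀ ≤ D by omega)) le_rfl)
  simp only [MonoidHom.coe_comp, Function.comp_apply, inv_mul_cancel_right] at h2
  refine h2.mono le_rfl (le_trans ?_ (hD' u.norm))
  set a := C₁ + Cθ + Cκ * C₀ + 1 with ha
  have h4 : affineUp M C₀ (θ' u).norm ≤ affineUp M C₀ (a * u.norm + a) :=
    affineUp_mono hM le_rfl ((hCθ u).trans (by
      have := Nat.mul_le_mul_right u.norm (show Cθ ≤ a by omega)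
      omega))
  have h5 := Nat.le_mul_of_pos_left (affineUp M C₀ (a * u.norm + a)) (show 0 < a by omega)
  have h6 := Nat.le_mul_of_pos_left u.norm (show 0 < a by omega)
  omega

/-- Sorting a word into the two factors of a direct product takes quadratically many relators. -/
theorem exists_fillsIn_sort {k : ℕ} {Γ : Type*} [Group Γ] {π : FreeGroup (Fin k) →* Γ}
    {p q : Γ →* Γ} (hpq : ∀ x y, Commute (p x) (q y)) (hid : ∀ x, p x * q x = x)
    {f g : FreeGroup (Fin k) →* FreeGroup (Fin k)} (hf : ∀ u, π (f u) = p (π u))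
    (hg : ∀ u, π (g u) = q (π u)) :
    ∃ C, ∀ u, FillsIn (relBall π C) (u.norm ^ 2) (u * (f u * g u)⁻¹) := by
  obtain ⟨Cf, hCf⟩ := FreeGroup.hom_norm_le f
  obtain ⟨Cg, hCg⟩ := FreeGroup.hom_norm_le g
  let C := 2 * Cg + 2 * Cf + 1
  -- Conjugation by `g x` does not change `f` modulo the relations, so moving `g x` past `f u` costs
  -- one relator per letter of `u`.
  have comm : ∀ x u : FreeGroup (Fin k), x.norm ≤ 1 →
      FillsIn (relBall π C) u.norm (g x * f u * (g x)⁻¹ * (f u)⁻¹) := by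
    intro x u hx
    refine fillsIn_lift_div π ((MulAut.conj (g x)).toMonoidHom.comp f) f (fun u => ?_)
      (fun s => ?_) u
    · have := (hpq (π u) (π x)).eq
      simp [hf, hg, ← this]
    · have h1 := FreeGroup.norm_mul_le (g x * f (FreeGroup.of s)) (g x)⁻¹
      have h2 := FreeGroup.norm_mul_le (g x) (f (FreeGroup.of s))
      have h3 := (hCg x).trans (Nat.mul_le_mul_left _ hx)
      have h4 := hCf (FreeGroup.of s)
      rw [FreeGroup.norm_inv_eq] at h1
      rw [FreeGroup.norm_of] at h4
      simp only [MonoidHom.coe_comp, Function.comp_apply, MulEquiv.toMonoidHom_eq_coe,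
        MonoidHom.coe_coe, MulAut.conj_apply]
      omega
  have step : ∀ x u n, x.norm ≤ 1 → u.norm ≤ n →
      FillsIn (relBall π C) (n ^ 2) (u * (f u * g u)⁻¹) →
      FillsIn (relBall π C) ((n + 1) ^ 2) (x * u * (f (x * u) * g (x * u))⁻¹) := by
    intro x u n hx hu ih
    have h1 : FillsIn (relBall π C) 1 (x * (f x * g x)⁻¹) := by
      refine FillsIn.of_mem ⟨by rw [map_mul, map_inv, map_mul, hf, hg, hid, mul_inv_cancel], ?_⟩
      have h1 := FreeGroup.norm_mul_le x (f x * g x)⁻¹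
      have h2 := FreeGroup.norm_mul_le (f x) (g x)
      have h3 := (hCg x).trans (Nat.mul_le_mul_left _ hx)
      have h4 := (hCf x).trans (Nat.mul_le_mul_left _ hx)
      rw [FreeGroup.norm_inv_eq] at h1
      omega
    -- One relator splits the letter `x`, and at most `n` relators move `g x` past `f u`; `n ^ 2 + 1
    -- + n ≤ (n + 1) ^ 2`.
    have h2 := h1.div_mul ih
    have h3 : FillsIn (relBall π C) n
        ((f x * g x * (f u * g u)) * (f (x * u) * g (x * u))⁻¹) := by
      have := ((comm x u hx).mono le_rfl hu).conj (f x)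
      rw [map_mul, map_mul]
      simpa [mul_assoc] using this
    refine (h2.div_trans h3).mono le_rfl ?_
    nlinarith
  refine ⟨C, fun u => ?_⟩
  refine (FreeGroup.induct_norm (P := fun n u => u.norm ≤ n ∧
    FillsIn (relBall π C) (n ^ 2) (u * (f u * g u)⁻¹)) ?_ ?_ ?_ u).2
  · exact ⟨by simp, by simpa using FillsIn.one⟩
  · intro s n u ih
    have := FreeGroup.norm_mul_le (FreeGroup.of s) u
    rw [FreeGroup.norm_of] at this
    exact ⟨by omega, step _ _ _ (by simp) ih.1 ih.2⟩
  · intro s n u ih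
    have := FreeGroup.norm_mul_le (FreeGroup.of s)⁻¹ u
    rw [FreeGroup.norm_inv_eq, FreeGroup.norm_of] at this
    exact ⟨by omega, step _ _ _ (by simp) ih.1 ih.2⟩

/-- The Dehn function of a direct product, in terms of groups through which the projections to
the factors factor. -/
theorem DehnLE.of_commuting {Γ K₁ K₂ : Type*} [Group Γ] [Group K₁] [Group K₂] [Group.FG Γ]
    {M : ℕ → ℕ} (hM : Monotone M) (hsq : ∃ C, ∀ n, n ^ 2 ≤ affineUp M C n) {p q : Γ →* Γ}
    (hpq : ∀ x y, Commute (p x) (q y)) (hid : ∀ x, p x * q x = x)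
    (h₁ : DehnLE K₁ M) (θ₁ : Γ →* K₁) (κ₁ : K₁ →* Γ) (hp : ∀ x, κ₁ (θ₁ x) = p x)
    (h₂ : DehnLE K₂ M) (θ₂ : Γ →* K₂) (κ₂ : K₂ →* Γ) (hq : ∀ x, κ₂ (θ₂ x) = q x) :
    DehnLE Γ M := by
  obtain ⟨k, π, hπ⟩ := Group.FG.exists_surjective Γ
  obtain ⟨f, hf⟩ := exists_lift π hπ p
  obtain ⟨g, hg⟩ := exists_lift π hπ q
  obtain ⟨C₀, hC₀⟩ := hsq
  obtain ⟨C₁, hC₁⟩ := h₁.fillsIn_lift hM hπ θ₁ κ₁ hp hf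
  obtain ⟨C₂, hC₂⟩ := h₂.fillsIn_lift hM hπ θ₂ κ₂ hq hg
  obtain ⟨C₃, hC₃⟩ := exists_fillsIn_sort hpq hid hf hg
  refine ⟨k, π, hπ, (C₀ + C₁ + C₂) + C₃, fun u hu => ?_⟩
  have h3 := (hC₃ u).mono (relBall_mono π (show C₃ ≤ C₀ + C₁ + C₂ + C₃ by omega)) (hC₀ _)
  have h1 := (hC₁ u hu).mono (relBall_mono π (show C₁ ≤ C₀ + C₁ + C₂ + C₃ by omega)) le_rfl
  have h2 := (hC₂ u hu).mono (relBall_mono π (show C₂ ≤ C₀ + C₁ + C₂ + C₃ by omega)) le_rfl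
  have h4 := h3.mul (h1.mul h2)
  rw [inv_mul_cancel_right, ← add_assoc] at h4
  refine h4.mono le_rfl ?_
  have e1 := affineUp_add hM C₀ C₁ u.norm
  have e2 := affineUp_add hM (C₀ + C₁) C₂ u.norm
  have e3 := affineUp_mono hM (Nat.le_add_right (C₀ + C₁ + C₂) C₃) (le_refl u.norm)
  omega

theorem exists_dehnLE_prod {A B : Type*} [Group A] [Group B] {M₁ M₂ : ℕ → ℕ} (h₁ : DehnLE A M₁)
    (hM₁ : Monotone M₁) (h₂ : DehnLE B M₂) (hM₂ : Monotone M₂) :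
    ∃ M, Monotone M ∧ DehnLE (A × B) M := by
  have := h₁.fg
  have := h₂.fg
  have hM : Monotone fun n => M₁ n + M₂ n + n ^ 2 := fun a b h =>
    Nat.add_le_add (Nat.add_le_add (hM₁ h) (hM₂ h)) (Nat.pow_le_pow_left h 2)
  refine ⟨_, hM, DehnLE.of_commuting hM ⟨1, fun n => ?_⟩
    (p := (MonoidHom.inl A B).comp (MonoidHom.fst A B))
    (q := (MonoidHom.inr A B).comp (MonoidHom.snd A B)) ?_ ?_
    (h₁.mono fun n => ?_) (MonoidHom.fst A B) (MonoidHom.inl A B) (fun _ => rfl)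
    (h₂.mono fun n => ?_) (MonoidHom.snd A B) (MonoidHom.inr A B) (fun _ => rfl)⟩
  · have := Nat.pow_le_pow_left (show n ≤ n + 1 by omega) 2
    simp only [affineUp, one_mul]
    omega
  · intro x y
    ext <;> simp
  · intro x
    ext <;> simp
  · simp only; omega
  · simp only; omega

/-- Supplies some finite Dehn bound for the product, enough to prove that the kernel is finitely
presented before a presentation of the product is chosen. -/
theorem exists_dehnLE_pi {r : ℕ} (G : Fin r → Type*) [∀ i, Group (G i)]
    (hG : ∀ i, Group.IsFinitelyPresented (G i)) : ∃ M, Monotone M ∧ DehnLE (∀ i, G i) M := by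
  induction r with
  | zero =>
    refine ⟨fun n => n, monotone_id, 0, 1, fun g => ⟨1, Subsingleton.elim _ _⟩, 0, fun g _ => ?_⟩
    rw [Subsingleton.elim g 1]
    exact FillsIn.one
  | succ r ih =>
    obtain ⟨P⟩ := (FinitePresentation.nonempty_iff _).2 (hG 0)
    obtain ⟨M, hM, h⟩ := ih (fun i => G i.succ) fun i => hG i.succ
    obtain ⟨M', hM', h'⟩ := exists_dehnLE_prod P.dehnLE P.dehn_mono h hM
    refine ⟨M', hM', h'.of_retract hM'
      { toFun := fun g => (g 0, fun i => g i.succ), map_one' := rfl, map_mul' := fun _ _ => rfl }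
      { toFun := fun g => Fin.cons g.1 g.2, map_one' := ?_, map_mul' := ?_ } ?_⟩
    · funext i
      refine Fin.cases ?_ (fun i => ?_) i <;> simp
    · intro x y
      funext i
      refine Fin.cases ?_ (fun i => ?_) i <;> simp
    · intro g
      funext i
      refine Fin.cases ?_ (fun i => ?_) i <;> simp

/-! ### Split systems and the formal calculus of families -/

/-- Four groups with homomorphisms to two abelian groups `L true` and `L false`, together with
sections of these homomorphisms whose images are killed by the other homomorphism. -/
structure SplitSystem (A : Fin 4 → Type*) [∀ b, Group (A b)] (L : Bool → Type*)
    [∀ h, CommGroup (L h)] where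
  /-- the homomorphisms -/
  φ : ∀ h b, A b →* L h
  /-- the sections -/
  t : ∀ h b, L h →* A b
  φ_t : ∀ h b v, φ h b (t h b v) = v
  φ_t_not : ∀ h b v, φ h b (t (!h) b v) = 1

/-- The endomorphism of a direct product that projects to one factor. -/
def factorProj {I : Type*} [DecidableEq I] (A : I → Type*) [∀ b, Group (A b)] (b : I) :
    (∀ b, A b) →* (∀ b, A b) :=
  (MonoidHom.mulSingle A b).comp (Pi.evalMonoidHom A b)

theorem factorProj_apply {I : Type*} [DecidableEq I] {A : I → Type*} [∀ b, Group (A b)] (b : I)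
    (g : ∀ b, A b) (c : I) : factorProj A b g c = if c = b then g c else 1 := by
  by_cases h : c = b
  · subst h; simp [factorProj]
  · simp [factorProj, h]

theorem factorProj_comm {I : Type*} [DecidableEq I] {A : I → Type*} [∀ b, Group (A b)] {b c : I}
    (h : b ≠ c) (x y : ∀ b, A b) : Commute (factorProj A b x) (factorProj A c y) := by
  funext d
  simp only [Pi.mul_apply, factorProj_apply]
  by_cases h1 : d = b
  · subst h1; simp [h]
  · simp [h1]

theorem factorProj_factorProj {I : Type*} [DecidableEq I] {A : I → Type*} [∀ b, Group (A b)]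
    {b c : I} (h : b ≠ c) (x : ∀ b, A b) : factorProj A b (factorProj A c x) = 1 := by
  funext d
  simp only [factorProj_apply, Pi.one_apply]
  by_cases h1 : d = b
  · subst h1; simp [h]
  · simp [h1]

/-- A representation, in a group `Q`, of the families of elements of `G` in some group of families
by means of homomorphisms from `G` to a subgroup `K`, functorial in these homomorphisms. -/
structure FamilyRep {G : Type*} [Group G] (K : Subgroup G) (ι Q : Type*) [Group Q] where
  /-- the families -/
  fam : Subgroup (ι → G)
  map_mem : ∀ η : G →* G, ∀ x ∈ fam, (fun i => η (x i)) ∈ fam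
  /-- the representation -/
  Θ : (G →* G) → fam →* Q
  comp' : ∀ α η : G →* G, (∀ x, α x ∈ K) → ∀ x : fam,
    Θ (α.comp η) x = Θ α ⟨fun i => η (x.1 i), map_mem η x.1 x.2⟩

namespace FamilyRep

section general

variable {G ι Q : Type*} [Group G] [Group Q] {K : Subgroup G} (S : FamilyRep K ι Q)

/-- The action of endomorphisms on families. -/
def push (η : G →* G) : S.fam →* S.fam where
  toFun x := ⟨fun i => η (x.1 i), S.map_mem η x.1 x.2⟩
  map_one' := by ext i; simp
  map_mul' x y := by ext i; simp

@[simp] theorem push_apply (η : G →* G) (x : S.fam) (i : ι) : (S.push η x).1 i = η (x.1 i) := rfl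

theorem Θ_push {α : G →* G} (hα : ∀ x, α x ∈ K) (η : G →* G) (x : S.fam) :
    S.Θ α (S.push η x) = S.Θ (α.comp η) x := (S.comp' α η hα x).symm

theorem Θ_congr {α β : G →* G} (h : ∀ g, α g = β g) (x : S.fam) : S.Θ α x = S.Θ β x := by
  rw [MonoidHom.ext h]

theorem fam_ext {x y : S.fam} (h : ∀ i, x.1 i = y.1 i) : x = y := Subtype.ext (funext h)

end general

variable {I ι Q : Type*} [DecidableEq I] [Group Q] {A : I → Type*} [∀ b, Group (A b)]
  {K : Subgroup (∀ b, A b)} (S : FamilyRep K ι Q)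

theorem exists_mulHom {G : Type*} [Group G] {α β : G →* G} (h : ∀ x y, Commute (α x) (β y)) :
    ∃ ψ : G →* G, ∀ x, ψ x = α x * β x :=
  ⟨MonoidHom.mk' (fun x => α x * β x) fun x y => by
    rw [map_mul, map_mul, mul_assoc, mul_assoc, ← mul_assoc (α y), ← mul_assoc (β x),
      (h y x).eq], fun _ => rfl⟩

section

variable {S} {i b : I} (hib : i ≠ b) {α β : (∀ b, A b) →* (∀ b, A b)}
  (hαK : ∀ x, α x ∈ K) (hβK : ∀ x, β x ∈ K)
  (hα : ∀ g, α (factorProj A i g) = α g) (hβ : ∀ g, β (factorProj A b g) = β g)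
  (hc : ∀ x y, Commute (α x) (β y))

include hib hα hβ in
theorem eq_one_of_ne : (∀ g, α (factorProj A b g) = 1) ∧ ∀ g, β (factorProj A i g) = 1 := by
  constructor <;> intro g
  · rw [← hα, factorProj_factorProj hib, map_one]
  · rw [← hβ, factorProj_factorProj hib.symm, map_one]

include hib hαK hβK hα hβ hc

/-- `Θ` need not respect pointwise products of homomorphisms. Here `α` and `β` depend on different
factors and commute, so `ψ = α * β` is itself a homomorphism into `K`. The product is then formed
inside the family, where `Θ ψ` is multiplicative. -/
theorem Θ_mul {γ η : (∀ b, A b) →* (∀ b, A b)} (hη : ∀ g, factorProj A b (η g) = η g)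
    (hγ : ∀ g, γ g = α g * β (η g)) (x : S.fam) :
    S.Θ γ x = S.Θ α x * S.Θ β (S.push η x) := by
  obtain ⟨ψ, hψ⟩ := exists_mulHom hc
  obtain ⟨h1, h2⟩ := eq_one_of_ne hib hα hβ
  obtain ⟨η', hη'⟩ := exists_mulHom (α := factorProj A i) (β := η) fun x y => by
    rw [← hη]; exact factorProj_comm hib _ _
  have hψK : ∀ x, ψ x ∈ K := fun x => by rw [hψ]; exact mul_mem (hαK x) (hβK x)
  have e1 : S.push η' x = S.push (factorProj A i) x * S.push η x :=
    S.fam_ext fun j => hη' _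
  have e2 : S.Θ γ x = S.Θ ψ (S.push η' x) := by
    rw [S.Θ_push hψK]
    refine S.Θ_congr (fun g => ?_) x
    have h3 : α (η g) = 1 := by rw [← hη, h1]
    simp only [MonoidHom.comp_apply, hψ, hη', map_mul, hα, h2, h3, hγ, mul_one, one_mul]
  rw [e2, e1, map_mul, S.Θ_push hψK, S.Θ_push hψK, S.Θ_push hβK]
  congr 1
  · refine S.Θ_congr (fun g => ?_) x
    simp only [MonoidHom.comp_apply, hψ, hα, h2, mul_one]
  · refine S.Θ_congr (fun g => ?_) x
    have h3 : α (η g) = 1 := by rw [← hη, h1]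
    simp only [MonoidHom.comp_apply, hψ, h3, one_mul]

/-- Both sides are values of the single homomorphism `Θ ψ`, `ψ = α * β`, on families supported in
different factors, which commute already as families. -/
theorem Θ_commute (x y : S.fam) : Commute (S.Θ α x) (S.Θ β y) := by
  obtain ⟨ψ, hψ⟩ := exists_mulHom hc
  obtain ⟨h1, h2⟩ := eq_one_of_ne hib hα hβ
  have hψK : ∀ x, ψ x ∈ K := fun x => by rw [hψ]; exact mul_mem (hαK x) (hβK x)
  have e1 : S.Θ α x = S.Θ ψ (S.push (factorProj A i) x) := by
    rw [S.Θ_push hψK]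
    refine S.Θ_congr (fun g => ?_) x
    simp only [MonoidHom.comp_apply, hψ, hα, h2, mul_one]
  have e2 : S.Θ β y = S.Θ ψ (S.push (factorProj A b) y) := by
    rw [S.Θ_push hψK]
    refine S.Θ_congr (fun g => ?_) y
    simp only [MonoidHom.comp_apply, hψ, hβ, h1, one_mul]
  rw [e1, e2]
  refine Commute.map (S.fam_ext fun j => ?_) _
  exact factorProj_comm hib _ _

end

end FamilyRep

theorem eq_or_of_nodup {i i' j k : Fin 4} (H : [i, i', j, k].Nodup) (c : Fin 4) :
    c = i ∨ c = i' ∨ c = j ∨ c = k := by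
  revert i i' j k c
  decide

/-! ### Embeddings of factors in the coabelian subgroup -/

namespace SplitSystem

variable {A : Fin 4 → Type*} [∀ b, Group (A b)] {L : Bool → Type*} [∀ h, CommGroup (L h)]
  (D : SplitSystem A L)

/-- The total homomorphism on the direct product. -/
def total (h : Bool) : (∀ b, A b) →* L h := ∏ b, (D.φ h b).comp (Pi.evalMonoidHom A b)

theorem total_apply (h : Bool) (g : ∀ b, A b) : D.total h g = ∏ b, D.φ h b (g b) := by
  simp [total, MonoidHom.finsetProd_apply]

theorem total_eq {i i' j k : Fin 4} (H : [i, i', j, k].Nodup) (h : Bool) (g : ∀ b, A b) :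
    D.total h g = D.φ h i (g i) * D.φ h i' (g i') * D.φ h j (g j) * D.φ h k (g k) := by
  have : (Finset.univ : Finset (Fin 4)) = {i, i', j, k} := by
    ext c
    simpa using eq_or_of_nodup H c
  rw [total_apply, this]
  simp only [List.nodup_cons, List.mem_cons, List.not_mem_nil, or_false, not_or] at H
  obtain ⟨⟨h1, h2, h3⟩, ⟨h4, h5⟩, h6, -⟩ := H
  rw [Finset.prod_insert (by simp [h1, h2, h3]), Finset.prod_insert (by simp [h4, h5]),
    Finset.prod_insert (by simp [h6]), Finset.prod_singleton]
  simp only [mul_assoc]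

/-- The coabelian subgroup: the common kernel of the total homomorphisms. -/
def coabelian : Subgroup (∀ b, A b) := (D.total true).ker ⊓ (D.total false).ker

theorem mem_coabelian {g : ∀ b, A b} : g ∈ D.coabelian ↔ ∀ h, D.total h g = 1 := by
  simp [coabelian, MonoidHom.mem_ker, and_comm]

/-- The factor `i`, embedded in the coabelian subgroup by means of the sections in the
factors `j` and `k`. -/
def twist (i : Fin 4) (h : Bool) (j k : Fin 4) : (∀ b, A b) →* (∀ b, A b) :=
  MonoidHom.pi fun c =>
    if c = i then Pi.evalMonoidHom A c
    else if c = j then (D.t h c).comp ((D.φ h i).comp (Pi.evalMonoidHom A i))⁻¹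
    else if c = k then (D.t (!h) c).comp ((D.φ (!h) i).comp (Pi.evalMonoidHom A i))⁻¹
    else 1

theorem twist_apply (i : Fin 4) (h : Bool) (j k : Fin 4) (g : ∀ b, A b) (c : Fin 4) :
    D.twist i h j k g c = if c = i then g c else if c = j then D.t h c (D.φ h i (g i))⁻¹
      else if c = k then D.t (!h) c (D.φ (!h) i (g i))⁻¹ else 1 := by
  simp only [twist, MonoidHom.pi_apply]
  split_ifs <;> rfl

/-- The section in the factor `j`, evaluated at the inverse of the image of the factor `i`. -/
def shift (h : Bool) (j i : Fin 4) : (∀ b, A b) →* (∀ b, A b) :=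
  MonoidHom.pi fun c =>
    if c = j then (D.t h c).comp ((D.φ h i).comp (Pi.evalMonoidHom A i))⁻¹ else 1

theorem shift_apply (h : Bool) (j i : Fin 4) (g : ∀ b, A b) (c : Fin 4) :
    D.shift h j i g c = if c = j then D.t h c (D.φ h i (g i))⁻¹ else 1 := by
  simp only [shift, MonoidHom.pi_apply]
  split_ifs <;> rfl

/-- The difference of the sections in the factors `j` and `k`, evaluated at the image of the
factor `j`. -/
def flat (h : Bool) (j k : Fin 4) : (∀ b, A b) →* (∀ b, A b) :=
  MonoidHom.pi fun c =>
    if c = j then (D.t h c).comp ((D.φ h j).comp (Pi.evalMonoidHom A j))⁻¹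
    else if c = k then (D.t h c).comp ((D.φ h j).comp (Pi.evalMonoidHom A j)) else 1

theorem flat_apply (h : Bool) (j k : Fin 4) (g : ∀ b, A b) (c : Fin 4) :
    D.flat h j k g c = if c = j then D.t h c (D.φ h j (g j))⁻¹
      else if c = k then D.t h c (D.φ h j (g j)) else 1 := by
  simp only [flat, MonoidHom.pi_apply]
  split_ifs <;> rfl

theorem φ_not_t (h : Bool) (b : Fin 4) (v : L h) : D.φ (!h) b (D.t h b v) = 1 := by
  cases h
  · exact D.φ_t_not true b v
  · exact D.φ_t_not false b v

theorem twist_not (i : Fin 4) (h : Bool) {j k : Fin 4} (hjk : j ≠ k) (g : ∀ b, A b) :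
    D.twist i (!h) k j g = D.twist i h j k g := by
  funext c
  cases h <;> simp only [twist_apply] <;> split_ifs <;>
    first | rfl | (subst_vars; contradiction)

theorem t_commute (h : Bool) (b : Fin 4) (v w : L h) : Commute (D.t h b v) (D.t h b w) :=
  (Commute.all v w).map (D.t h b)

theorem flat_factorProj (h : Bool) (j k : Fin 4) (g : ∀ b, A b) : D.flat h j k (factorProj A j g) = D.flat h j k g := by
  funext c
  simp [flat_apply, factorProj_apply]

theorem shift_factorProj (h : Bool) (j i : Fin 4) (g : ∀ b, A b) : factorProj A j (D.shift h j i g) = D.shift h j i g := by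
  funext c
  simp only [factorProj_apply, shift_apply]
  split_ifs <;> rfl

section

variable {i i' j k : Fin 4} (H : [i, i', j, k].Nodup) (h : Bool)
include H

theorem twist_mem (g : ∀ b, A b) : D.twist i h j k g ∈ D.coabelian := by
  rw [mem_coabelian]
  intro h'
  rw [D.total_eq H]
  simp only [List.nodup_cons, List.mem_cons, List.not_mem_nil, or_false, not_or] at H
  obtain ⟨⟨h1, h2, h3⟩, ⟨h4, h5⟩, h6, -⟩ := H
  simp only [twist_apply, if_true, Ne.symm h1, Ne.symm h2, Ne.symm h3, h4, h5, Ne.symm h6,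
    if_false, map_one, mul_one]
  obtain rfl | rfl : h' = h ∨ h' = !h := by cases h <;> cases h' <;> simp
  · rw [D.φ_t, D.φ_t_not, mul_one, mul_inv_cancel]
  · rw [D.φ_t, D.φ_not_t, mul_one, mul_inv_cancel]

theorem flat_mem (g : ∀ b, A b) : D.flat h j k g ∈ D.coabelian := by
  rw [mem_coabelian]
  intro h'
  rw [D.total_eq H]
  simp only [List.nodup_cons, List.mem_cons, List.not_mem_nil, or_false, not_or] at H
  obtain ⟨⟨h1, h2, h3⟩, ⟨h4, h5⟩, h6, -⟩ := H
  simp only [flat_apply, if_true, h2, h3, h4, h5, Ne.symm h6,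
    if_false, map_one, one_mul]
  obtain rfl | rfl : h' = h ∨ h' = !h := by cases h <;> cases h' <;> simp
  · rw [D.φ_t, D.φ_t, inv_mul_cancel]
  · rw [D.φ_not_t, D.φ_not_t, mul_one]

theorem twist_factorProj (g : ∀ b, A b) :
    D.twist i h j k (factorProj A i g) = D.twist i h j k g := by
  funext c
  by_cases h1 : c = i
  · subst h1; simp [twist_apply, factorProj_apply]
  · simp [twist_apply, factorProj_apply, h1]

/-- In the factors `j` and `k`, both twists take values in the image of one and the same section,
which is abelian. -/
theorem twist_commute (x y : ∀ b, A b) :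
    Commute (D.twist i h j k x) (D.twist i' h j k y) := by
  funext c
  have H' := H
  simp only [List.nodup_cons, List.mem_cons, List.not_mem_nil, or_false, not_or] at H
  obtain ⟨⟨h1, h2, h3⟩, ⟨h4, h5⟩, h6, -⟩ := H
  simp only [Pi.mul_apply, twist_apply]
  rcases eq_or_of_nodup H' c with rfl | rfl | rfl | rfl
  · simp [h1, h2, h3]
  · simp [Ne.symm h1, h4, h5]
  · simp only [Ne.symm h2, Ne.symm h4, if_false, if_true]
    exact D.t_commute _ _ _ _
  · simp only [Ne.symm h3, Ne.symm h5, Ne.symm h6, if_false, if_true]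
    exact D.t_commute _ _ _ _

/-- The supports meet only in `j`, where both use the section of the half `!h`. -/
theorem twist_commute_flat (x y : ∀ b, A b) :
    Commute (D.twist i h i' j x) (D.flat (!h) j k y) := by
  funext c
  have H' := H
  simp only [List.nodup_cons, List.mem_cons, List.not_mem_nil, or_false, not_or] at H
  obtain ⟨⟨h1, h2, h3⟩, ⟨h4, h5⟩, h6, -⟩ := H
  simp only [Pi.mul_apply, twist_apply, flat_apply]
  rcases eq_or_of_nodup H' c with rfl | rfl | rfl | rfl
  · simp [h2, h3]
  · simp [h4, h5]
  · simp only [Ne.symm h2, Ne.symm h4, if_false, if_true]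
    exact D.t_commute _ _ _ _
  · simp [Ne.symm h3, Ne.symm h5, Ne.symm h6]

/-- Exchange of the factor that carries the second section. -/
theorem twist_eq_mul_flat (g : ∀ b, A b) : D.twist i h i' k g =
    D.twist i h i' j g * D.flat (!h) j k (D.shift (!h) j i g) := by
  funext c
  have H' := H
  simp only [List.nodup_cons, List.mem_cons, List.not_mem_nil, or_false, not_or] at H
  obtain ⟨⟨h1, h2, h3⟩, ⟨h4, h5⟩, h6, -⟩ := H
  simp only [Pi.mul_apply, twist_apply, flat_apply, shift_apply, if_true, map_inv,
    D.φ_t, inv_inv]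
  rcases eq_or_of_nodup H' c with rfl | rfl | rfl | rfl
  · simp [h2, h3]
  · simp [Ne.symm h1, h4, h5]
  · simp [Ne.symm h2, Ne.symm h4, h6]
  · simp [Ne.symm h3, Ne.symm h5, Ne.symm h6]

/-- The shifted element in the factor `i'` is killed by `φ h`. Its twist therefore adds nothing in
`j` and cancels the entry in `k`. -/
theorem twist_eq_mul_twist (g : ∀ b, A b) : D.twist i h j i' g =
    D.twist i h j k g * D.twist i' h j k (D.shift (!h) i' i g) := by
  funext c
  have H' := H
  simp only [List.nodup_cons, List.mem_cons, List.not_mem_nil, or_false, not_or] at H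
  obtain ⟨⟨h1, h2, h3⟩, ⟨h4, h5⟩, h6, -⟩ := H
  simp only [Pi.mul_apply, twist_apply, shift_apply, if_true, D.φ_t, D.φ_t_not, inv_inv]
  rcases eq_or_of_nodup H' c with rfl | rfl | rfl | rfl
  · simp [h1, h2, h3]
  · simp [Ne.symm h1, h4, h5]
  · simp [Ne.symm h2, Ne.symm h4]
  · simp [Ne.symm h3, Ne.symm h5, Ne.symm h6]

end

end SplitSystem

theorem perms_of_nodup {i i' j k : Fin 4} (H : [i, i', j, k].Nodup) :
    [i', i, j, k].Nodup ∧ [i, k, i', j].Nodup ∧ [i, k, j, i'].Nodup ∧ [i, j, i', k].Nodup ∧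
      [i, i', k, j].Nodup ∧ [i', i, k, j].Nodup ∧ [i', k, i, j].Nodup ∧ [i', j, i, k].Nodup ∧
      [j, k, i, i'].Nodup ∧ [i, j, k, i'].Nodup ∧ [i', k, j, i].Nodup := by
  revert i i' j k
  decide

namespace SplitSystem

variable {A : Fin 4 → Type*} [∀ b, Group (A b)] {L : Bool → Type*} [∀ h, CommGroup (L h)]
  (D : SplitSystem A L)

/-- The product of the factors `i` and `i'`, embedded in the coabelian subgroup by means of the
sections in the factors `j` and `k`. -/
def pair (i i' : Fin 4) (h : Bool) (j k : Fin 4) : (∀ b, A b) →* (∀ b, A b) :=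
  MonoidHom.pi fun c =>
    if c = i ∨ c = i' then Pi.evalMonoidHom A c
    else if c = j then (D.t h c).comp
      ((D.φ h i).comp (Pi.evalMonoidHom A i) * (D.φ h i').comp (Pi.evalMonoidHom A i'))⁻¹
    else if c = k then (D.t (!h) c).comp
      ((D.φ (!h) i).comp (Pi.evalMonoidHom A i) * (D.φ (!h) i').comp (Pi.evalMonoidHom A i'))⁻¹
    else 1

theorem pair_apply (i i' : Fin 4) (h : Bool) (j k : Fin 4) (g : ∀ b, A b) (c : Fin 4) :
    D.pair i i' h j k g c = if c = i ∨ c = i' then g c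
      else if c = j then D.t h c (D.φ h i (g i) * D.φ h i' (g i'))⁻¹
      else if c = k then D.t (!h) c (D.φ (!h) i (g i) * D.φ (!h) i' (g i'))⁻¹ else 1 := by
  simp only [pair, MonoidHom.pi_apply]
  split_ifs <;> rfl

/-- The sections in the factors `j` and `k`, evaluated at the images of the factors `i`
and `i'`. -/
def sec (i i' : Fin 4) (h : Bool) (j k : Fin 4) : (∀ b, A b) →* (∀ b, A b) :=
  MonoidHom.pi fun c =>
    if c = j then (D.t h c).comp
      ((D.φ h i).comp (Pi.evalMonoidHom A i) * (D.φ h i').comp (Pi.evalMonoidHom A i'))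
    else if c = k then (D.t (!h) c).comp
      ((D.φ (!h) i).comp (Pi.evalMonoidHom A i) * (D.φ (!h) i').comp (Pi.evalMonoidHom A i'))
    else 1

theorem sec_apply (i i' : Fin 4) (h : Bool) (j k : Fin 4) (g : ∀ b, A b) (c : Fin 4) :
    D.sec i i' h j k g c = if c = j then D.t h c (D.φ h i (g i) * D.φ h i' (g i'))
      else if c = k then D.t (!h) c (D.φ (!h) i (g i) * D.φ (!h) i' (g i')) else 1 := by
  simp only [sec, MonoidHom.pi_apply]
  split_ifs <;> rfl

/-- The inverses of the values of `SplitSystem.sec`. -/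
def secInv (i i' : Fin 4) (h : Bool) (j k : Fin 4) : (∀ b, A b) →* (∀ b, A b) :=
  MonoidHom.pi fun c =>
    if c = j then (D.t h c).comp
      ((D.φ h i).comp (Pi.evalMonoidHom A i) * (D.φ h i').comp (Pi.evalMonoidHom A i'))⁻¹
    else if c = k then (D.t (!h) c).comp
      ((D.φ (!h) i).comp (Pi.evalMonoidHom A i) * (D.φ (!h) i').comp (Pi.evalMonoidHom A i'))⁻¹
    else 1

theorem secInv_apply (i i' : Fin 4) (h : Bool) (j k : Fin 4) (g : ∀ b, A b) (c : Fin 4) :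
    D.secInv i i' h j k g c = if c = j then D.t h c (D.φ h i (g i) * D.φ h i' (g i'))⁻¹
      else if c = k then D.t (!h) c (D.φ (!h) i (g i) * D.φ (!h) i' (g i'))⁻¹ else 1 := by
  simp only [secInv, MonoidHom.pi_apply]
  split_ifs <;> rfl

section

variable {i i' j k : Fin 4} (H : [i, i', j, k].Nodup) (h : Bool)
include H

theorem pair_eq (g : ∀ b, A b) :
    D.pair i i' h j k g = D.twist i h j k g * D.twist i' h j k g := by
  funext c
  have H' := H
  simp only [List.nodup_cons, List.mem_cons, List.not_mem_nil, or_false, not_or] at H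
  obtain ⟨⟨h1, h2, h3⟩, ⟨h4, h5⟩, h6, -⟩ := H
  simp only [Pi.mul_apply, twist_apply, pair_apply]
  rcases eq_or_of_nodup H' c with rfl | rfl | rfl | rfl
  · simp [h1, h2, h3]
  · simp [Ne.symm h1, h4, h5]
  · simp only [Ne.symm h2, Ne.symm h4, if_false, if_true, or_self, mul_inv, map_mul]
  · simp only [Ne.symm h3, Ne.symm h5, Ne.symm h6, if_false, if_true, or_self, mul_inv, map_mul]

theorem pair_mem (g : ∀ b, A b) : D.pair i i' h j k g ∈ D.coabelian := by
  rw [D.pair_eq H]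
  exact mul_mem (D.twist_mem H h g) (D.twist_mem (perms_of_nodup H).1 h g)

/-- The two complementary embeddings overlap in the section values: both sides carry them in `i`,
`i'` and their inverses in `j`, `k`. This allows section values to be moved from one pair of factors
to the other. -/
theorem pair_sec (g : ∀ b, A b) :
    D.pair i i' h j k (D.sec i i' h i i' g) = D.pair j k h i i' (D.secInv i i' h j k g) := by
  funext c
  have H' := H
  simp only [List.nodup_cons, List.mem_cons, List.not_mem_nil, or_false, not_or] at H
  obtain ⟨⟨h1, h2, h3⟩, ⟨h4, h5⟩, h6, -⟩ := H
  simp only [pair_apply, sec_apply, secInv_apply, if_true, Ne.symm h1, Ne.symm h6, if_false,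
    D.φ_t, D.φ_t_not, D.φ_not_t, mul_one, one_mul, inv_inv]
  rcases eq_or_of_nodup H' c with rfl | rfl | rfl | rfl
  · simp [h2, h3]
  · simp [Ne.symm h1, h4, h5]
  · simp [Ne.symm h2, Ne.symm h4]
  · simp [Ne.symm h3, Ne.symm h5, Ne.symm h6]

end

end SplitSystem

/-! ### Multiplicativity of the normal form in a representation -/

namespace FamilyRep

open SplitSystem

variable {A : Fin 4 → Type*} [∀ b, Group (A b)] {L : Bool → Type*} [∀ h, CommGroup (L h)]
  {D : SplitSystem A L} {ι Q : Type*} [Group Q] (S : FamilyRep D.coabelian ι Q)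

section

variable {i i' j k : Fin 4} (H : [i, i', j, k].Nodup) (h : Bool)

theorem ne_of_nodup (H : [i, i', j, k].Nodup) : i ≠ i' ∧ i ≠ j ∧ i ≠ k ∧ i' ≠ j ∧ i' ≠ k ∧ j ≠ k := by
  simpa [and_assoc] using H

include H

theorem Θ_twist_commute (x y : S.fam) :
    Commute (S.Θ (D.twist i h j k) x) (S.Θ (D.twist i' h j k) y) :=
  Θ_commute (ne_of_nodup H).1 (D.twist_mem H h) (D.twist_mem (perms_of_nodup H).1 h)
    (D.twist_factorProj H h) (D.twist_factorProj (perms_of_nodup H).1 h) (D.twist_commute H h) x y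

theorem Θ_pair (x : S.fam) : S.Θ (D.pair i i' h j k) x =
    S.Θ (D.twist i h j k) x * S.Θ (D.twist i' h j k) x := by
  have H' := (perms_of_nodup H).1
  rw [Θ_mul (S := S) (ne_of_nodup H).1 (D.twist_mem H h) (D.twist_mem H' h)
    (D.twist_factorProj H h) (D.twist_factorProj H' h) (D.twist_commute H h)
    (γ := D.pair i i' h j k) (η := factorProj A i') ?_ ?_ x, S.Θ_push (D.twist_mem H' h)]
  · congr 1
    exact S.Θ_congr (D.twist_factorProj H' h) x
  · intro g
    funext c
    simp only [factorProj_apply]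
    split_ifs <;> rfl
  · intro g
    rw [D.twist_factorProj H' h, D.pair_eq H]

theorem Θ_twist_eq_mul_flat (x : S.fam) : S.Θ (D.twist i h i' k) x =
    S.Θ (D.twist i h i' j) x * S.Θ (D.flat (!h) j k) (S.push (D.shift (!h) j i) x) := by
  obtain ⟨-, Hk, -⟩ := perms_of_nodup H
  exact Θ_mul (ne_of_nodup H).2.1 (D.twist_mem Hk h) (D.flat_mem H (!h))
    (D.twist_factorProj Hk h) (D.flat_factorProj (!h) j k) (D.twist_commute_flat H h)
    (D.shift_factorProj (!h) j i) (D.twist_eq_mul_flat H h) x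

theorem Θ_twist_eq_mul_twist (x : S.fam) : S.Θ (D.twist i h j i') x =
    S.Θ (D.twist i h j k) x * S.Θ (D.twist i' h j k) (S.push (D.shift (!h) i' i) x) := by
  have H' := (perms_of_nodup H).1
  exact Θ_mul (ne_of_nodup H).1 (D.twist_mem H h) (D.twist_mem H' h)
    (D.twist_factorProj H h) (D.twist_factorProj H' h) (D.twist_commute H h)
    (D.shift_factorProj (!h) i' i) (D.twist_eq_mul_twist H h) x

/-- When `φ (!h)` vanishes, the factor carrying the half `!h` is immaterial also in the
representation: the correction term is evaluated at a trivial family. -/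
theorem Θ_twist_right (x : S.fam) (hx : ∀ n, D.φ (!h) i (x.1 n i) = 1) :
    S.Θ (D.twist i h i' k) x = S.Θ (D.twist i h i' j) x := by
  have : S.push (D.shift (!h) j i) x = 1 := S.fam_ext fun n => by
    funext c
    simp [shift_apply, hx]
  rw [S.Θ_twist_eq_mul_flat H, this, map_one, mul_one]

theorem Θ_twist_left (x : S.fam) (hx : ∀ n, D.φ h i (x.1 n i) = 1) :
    S.Θ (D.twist i h k i') x = S.Θ (D.twist i h j i') x := by
  obtain ⟨h1, h2, h3, h4, h5, h6⟩ := ne_of_nodup H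
  rw [← S.Θ_congr (D.twist_not i h h5.symm), ← S.Θ_congr (D.twist_not i h h4.symm)]
  exact S.Θ_twist_right H (!h) x fun n => by cases h <;> exact hx n

/-- The `!h` section of the second twist is moved from `k` to `j` at the cost of a flat term, which
commutes with the first twist. Since `φ h` vanishes, the `h` sections of both twists may be moved to
`k`; the twists then use the same two factors. -/
theorem Θ_twist_commute_of_eq_one (x y : S.fam) (hx : ∀ n, D.φ h i (x.1 n i) = 1)
    (hy : ∀ n, D.φ h i' (y.1 n i') = 1) :
    Commute (S.Θ (D.twist i h i' j) x) (S.Θ (D.twist i' h i k) y) := by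
  obtain ⟨H1, H2, H3, H4, H5, H6, H7, H8, -, H10, H11⟩ := perms_of_nodup H
  rw [S.Θ_twist_eq_mul_flat H1]
  refine Commute.mul_right ?_ ?_
  · rw [← S.Θ_twist_left (i' := j) (k := k) (j := i') (by exact H4) h x hx,
      ← S.Θ_twist_left (i' := j) (k := k) (j := i) (by exact H8) h y hy]
    exact S.Θ_twist_commute H5 h x y
  · exact Θ_commute (ne_of_nodup H).2.1 (D.twist_mem H2 h) (D.flat_mem H (!h))
      (D.twist_factorProj H2 h) (D.flat_factorProj (!h) j k) (D.twist_commute_flat H h) _ _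

/-- Section values are redistributed between `i` and `i'` so that the part in `i` is killed by `φ h`
and the part in `i'` by `φ (!h)`. What remains of the values of each part is cancelled by a section
in the other of these two factors. The correction terms disappear from the product. -/
theorem exists_Θ_pair (x : S.fam) (hK : ∀ n, x.1 n ∈ D.coabelian)
    (hj : ∀ n, x.1 n j = 1) (hk : ∀ n, x.1 n k = 1) :
    ∃ a b : S.fam, (∀ n, D.φ h i (a.1 n i) = 1) ∧ (∀ n, D.φ (!h) i' (b.1 n i') = 1) ∧
      S.Θ (D.pair i i' h j k) x = S.Θ (D.twist i h j i') a * S.Θ (D.twist i' h i k) b := by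
  obtain ⟨n1, n2, n3, n4, n5, n6⟩ := ne_of_nodup H
  obtain ⟨H1, H2, H3, H4, H5, H6, H7, H8, -, H10, H11⟩ := perms_of_nodup H
  have hφ : ∀ h n, D.φ h i (x.1 n i) * D.φ h i' (x.1 n i') = 1 := fun h n => by
    have := D.mem_coabelian.1 (hK n) h
    rw [D.total_eq H, hj, hk] at this
    simpa using this
  let s := S.push (D.shift h i i) x
  let s' := S.push (D.shift (!h) i' i) x
  let a := S.push (factorProj A i) x * s
  let b := s'⁻¹ * S.push (factorProj A i') x
  have ha : ∀ n, a.1 n i = x.1 n i * D.t h i (D.φ h i (x.1 n i))⁻¹ := fun n => by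
    change (factorProj A i (x.1 n) * D.shift h i i (x.1 n)) i = _
    simp [factorProj_apply, shift_apply]
  have hb : ∀ n, b.1 n i' = (D.t (!h) i' (D.φ (!h) i (x.1 n i))⁻¹)⁻¹ * x.1 n i' := fun n => by
    change ((D.shift (!h) i' i (x.1 n))⁻¹ * factorProj A i' (x.1 n)) i' = _
    simp [factorProj_apply, shift_apply]
  refine ⟨a, b, fun n => ?_, fun n => ?_, ?_⟩
  · rw [ha, map_mul, D.φ_t, mul_inv_cancel]
  · rw [hb, map_mul, map_inv, D.φ_t, inv_inv, hφ]
  have e1 : S.push (D.shift (!h) i' i) a = s' := S.fam_ext fun n => by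
    funext c
    simp only [push_apply, shift_apply, s', ha, map_mul, D.φ_not_t, mul_one]
  have e2 : S.push (D.shift h i i') b = s⁻¹ := S.fam_ext fun n => by
    funext c
    change D.shift h i i' (b.1 n) c = (D.shift h i i (x.1 n))⁻¹ c
    simp only [shift_apply, hb, map_mul, map_inv, D.φ_t_not, inv_one, one_mul, Pi.inv_apply,
      eq_inv_of_mul_eq_one_right (hφ h n)]
    split_ifs <;> simp
  have e3 : S.Θ (D.twist i' h i k) b = S.Θ (D.twist i' h j k) b * S.Θ (D.twist i h j k) s⁻¹ := by
    rw [← e2]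
    have := S.Θ_twist_eq_mul_twist (i := i') (i' := i) (j := k) (k := j) H6 (!h) b
    rw [S.Θ_congr (D.twist_not i' h n3), S.Θ_congr (D.twist_not i' h n6),
      S.Θ_congr (D.twist_not i h n6)] at this
    rw [this]
    congr 2
    refine S.fam_ext fun n => ?_
    cases h <;> rfl
  have e4 : S.Θ (D.twist i h j k) (S.push (factorProj A i) x) = S.Θ (D.twist i h j k) x := by
    rw [S.Θ_push (D.twist_mem H h)]
    exact S.Θ_congr (D.twist_factorProj H h) x
  have e5 : S.Θ (D.twist i' h j k) (S.push (factorProj A i') x) = S.Θ (D.twist i' h j k) x := by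
    rw [S.Θ_push (D.twist_mem H1 h)]
    exact S.Θ_congr (D.twist_factorProj H1 h) x
  have hcomm := S.Θ_twist_commute H h
  rw [S.Θ_twist_eq_mul_twist H, e1, e3, S.Θ_pair H]
  simp only [a, b, map_mul, map_inv, e4, e5]
  generalize hX : S.Θ (D.twist i h j k) x = X
  generalize hY : S.Θ (D.twist i' h j k) x = Y
  generalize hX' : S.Θ (D.twist i h j k) s = X'
  generalize hY' : S.Θ (D.twist i' h j k) s' = Y'
  have c1 : Commute X' Y := by rw [← hX', ← hY]; exact hcomm _ _
  rw [show X * X' * Y' * (Y'⁻¹ * Y * X'⁻¹) = X * (X' * Y * X'⁻¹) by group, c1.eq,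
    mul_inv_cancel_right]

/-- Elements of the coabelian subgroup that are supported in complementary pairs of factors commute
in the representation. -/
theorem Θ_pair_commute (x y : S.fam) (hxK : ∀ n, x.1 n ∈ D.coabelian)
    (hxj : ∀ n, x.1 n j = 1) (hxk : ∀ n, x.1 n k = 1) (hyK : ∀ n, y.1 n ∈ D.coabelian)
    (hyi : ∀ n, y.1 n i = 1) (hyi' : ∀ n, y.1 n i' = 1) :
    Commute (S.Θ (D.pair i i' h j k) x) (S.Θ (D.pair j k h i i') y) := by
  obtain ⟨n1, n2, n3, n4, n5, n6⟩ := ne_of_nodup H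
  obtain ⟨H1, H2, H3, H4, H5, H6, H7, H8, H9, H10, H11⟩ := perms_of_nodup H
  obtain ⟨a, b, ha, hb, e1⟩ := S.exists_Θ_pair H h x hxK hxj hxk
  obtain ⟨c, d, hc, hd, e2⟩ := S.exists_Θ_pair H9 h y hyK hyi hyi'
  rw [e1, e2]
  -- Of the four pairs of twists, two use the same carrying factors. The other two commute because
  -- their arguments are killed by a common half, `h` for `a`, `c` and `!h` for `b`, `d`.
  refine Commute.mul_left (Commute.mul_right ?_ ?_) (Commute.mul_right ?_ ?_)
  · exact S.Θ_twist_commute_of_eq_one H4 h a c ha hc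
  · exact S.Θ_twist_commute H3 h a d
  · exact S.Θ_twist_commute H8 h b c
  · rw [← S.Θ_congr (D.twist_not i' h n3), ← S.Θ_congr (D.twist_not k h n4.symm)]
    exact S.Θ_twist_commute_of_eq_one H7 (!h) b d hb hd

/-- Dividing `x` by its section values `z` leaves `x'` in the coabelian subgroup, supported in `i`,
`i'`, and hence commuting with `y` in the representation. By `pair_sec`, `z` turns into `w` in the
complementary embedding, and there conjugation takes place inside one homomorphism. -/
theorem Θ_pair_mul (y x : S.fam) (hyK : ∀ n, y.1 n ∈ D.coabelian)
    (hyi : ∀ n, y.1 n i = 1) (hyi' : ∀ n, y.1 n i' = 1) :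
    S.Θ (D.pair j k h i i') y * S.Θ (D.pair i i' h j k) x = S.Θ (D.pair i i' h j k) x *
      S.Θ (D.pair j k h i i') ((S.push (D.pair i i' h j k) x)⁻¹ * y *
        S.push (D.pair i i' h j k) x) := by
  obtain ⟨n1, n2, n3, n4, n5, n6⟩ := ne_of_nodup H
  have H9 := (perms_of_nodup H).2.2.2.2.2.2.2.2.1
  let z := S.push (D.sec i i' h i i') x
  let w := S.push (D.secInv i i' h j k) x
  let p := S.push (factorProj A i) x * S.push (factorProj A i') x
  let x' := p * z⁻¹
  have hp : ∀ n c, p.1 n c = if c = i ∨ c = i' then x.1 n c else 1 := fun n c => by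
    change factorProj A i (x.1 n) c * factorProj A i' (x.1 n) c = _
    simp only [factorProj_apply]
    by_cases h1 : c = i
    · subst h1; simp [n1]
    · simp [h1]
  have hz : ∀ n c, z.1 n c = D.sec i i' h i i' (x.1 n) c := fun _ _ => rfl
  have hx' : ∀ n c, x'.1 n c = p.1 n c * (z.1 n c)⁻¹ := fun _ _ => rfl
  have e1 : S.Θ (D.pair i i' h j k) x = S.Θ (D.pair i i' h j k) x' * S.Θ (D.pair j k h i i') w := by
    have h1 : S.Θ (D.pair j k h i i') w = S.Θ (D.pair i i' h j k) z := by
      rw [S.Θ_push (D.pair_mem H9 h), S.Θ_push (D.pair_mem H h)]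
      exact S.Θ_congr (fun g => (D.pair_sec H h g).symm) x
    have h2 : S.Θ (D.pair i i' h j k) p = S.Θ (D.pair i i' h j k) x := by
      obtain ⟨ψ, hψ⟩ := exists_mulHom (α := factorProj A i) (β := factorProj A i')
        fun x y => factorProj_comm n1 x y
      have h3 : p = S.push ψ x := S.fam_ext fun n => (hψ _).symm
      rw [h3, S.Θ_push (D.pair_mem H h)]
      refine S.Θ_congr (fun g => ?_) x
      funext c
      have h4 : ∀ c, c = i ∨ c = i' → ψ g c = g c := fun c hc => by
        rw [hψ, Pi.mul_apply, factorProj_apply, factorProj_apply]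
        rcases hc with rfl | rfl
        · simp [n1]
        · simp [n1.symm]
      simp only [MonoidHom.comp_apply, pair_apply, h4 i (Or.inl rfl), h4 i' (Or.inr rfl)]
      split_ifs with h5
      · exact h4 c h5
      all_goals rfl
    rw [h1, ← map_mul, ← h2]
    simp [x']
  have hcomm : Commute (S.Θ (D.pair i i' h j k) x') (S.Θ (D.pair j k h i i') y) := by
    refine S.Θ_pair_commute H h x' y (fun n => D.mem_coabelian.2 fun h' => ?_) ?_ ?_ hyK hyi hyi'
    · rw [D.total_eq H]
      obtain rfl | rfl : h' = h ∨ h' = !h := by cases h <;> cases h' <;> simp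
      · simp [hx', hp, hz, sec_apply, n1.symm, n2.symm, n3.symm, n4.symm, n5.symm, D.φ_t,
          D.φ_t_not, mul_comm]
      · simp [hx', hp, hz, sec_apply, n1.symm, n2.symm, n3.symm, n4.symm, n5.symm, D.φ_t,
          D.φ_not_t, mul_comm]
    · intro n
      simp [hx', hp, hz, sec_apply, n2.symm, n4.symm]
    · intro n
      simp [hx', hp, hz, sec_apply, n3.symm, n5.symm]
  -- In `j` and `k` the pair embedding has the same entries as `w`; in `i` and `i'` the family `y`
  -- is trivial.
  have e2 : (S.push (D.pair i i' h j k) x)⁻¹ * y * S.push (D.pair i i' h j k) x = w⁻¹ * y * w := by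
    refine S.fam_ext fun n => ?_
    funext c
    change (D.pair i i' h j k (x.1 n) c)⁻¹ * y.1 n c * D.pair i i' h j k (x.1 n) c =
      (D.secInv i i' h j k (x.1 n) c)⁻¹ * y.1 n c * D.secInv i i' h j k (x.1 n) c
    simp only [pair_apply, secInv_apply]
    rcases eq_or_of_nodup H c with rfl | rfl | rfl | rfl
    · simp [hyi, n2, n3]
    · simp [hyi', n4, n5]
    · simp [n2.symm, n4.symm]
    · simp [n3.symm, n5.symm]
  rw [e2, e1, ← mul_assoc, ← hcomm.eq, mul_assoc, mul_assoc]
  congr 1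
  rw [← map_mul, ← map_mul, mul_assoc, mul_inv_cancel_left]

end

/-- The normal form of elements of the coabelian subgroup is multiplicative. -/
theorem normalForm_mul {i i' j k : Fin 4} (H : [i, i', j, k].Nodup) (h : Bool) (x y : S.fam)
    (hxK : ∀ n, x.1 n ∈ D.coabelian) :
    S.Θ (D.pair i i' h j k) (x * y) * S.Θ (D.pair j k h i i')
      ((S.push (D.pair i i' h j k) (x * y))⁻¹ * (x * y)) =
    S.Θ (D.pair i i' h j k) x * S.Θ (D.pair j k h i i')
      ((S.push (D.pair i i' h j k) x)⁻¹ * x) *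
    (S.Θ (D.pair i i' h j k) y * S.Θ (D.pair j k h i i')
      ((S.push (D.pair i i' h j k) y)⁻¹ * y)) := by
  have hv : ∀ n c, ((S.push (D.pair i i' h j k) x)⁻¹ * x).1 n c =
    (D.pair i i' h j k (x.1 n) c)⁻¹ * x.1 n c := fun _ _ => rfl
  have key := S.Θ_pair_mul H h ((S.push (D.pair i i' h j k) x)⁻¹ * x) y
    (fun n => mul_mem (inv_mem (D.pair_mem H h _)) (hxK n))
    (fun n => by simp [hv, pair_apply]) (fun n => by simp [hv, pair_apply])
  rw [mul_assoc (S.Θ (D.pair i i' h j k) x), ← mul_assoc (S.Θ (D.pair j k h i i') _), key]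
  simp only [map_mul, map_inv]
  group

end FamilyRep

/-! ### Families of words modulo small area -/

section asymptotic

variable {k k' : ℕ} {G H ι : Type*} [Group G] [Group H]

/-- The families of words, indexed by a set with a size function `N`, that are filled by
relators of bounded length with an area asymptotically bounded by `M` of the size. -/
def nullFam (π : FreeGroup (Fin k) →* G) {M : ℕ → ℕ} (hM : Monotone M) (N : ι → ℕ) :
    Subgroup (ι → FreeGroup (Fin k)) where
  carrier := {u | ∃ C, ∀ i, FillsIn (relBall π C) (affineUp M C (N i)) (u i)}
  one_mem' := ⟨0, fun _ => FillsIn.one⟩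
  mul_mem' := by
    rintro u v ⟨C, hC⟩ ⟨D, hD⟩
    refine ⟨C + D, fun i => ?_⟩
    exact (((hC i).mono (relBall_mono π (Nat.le_add_right C D)) le_rfl).mul
      ((hD i).mono (relBall_mono π (Nat.le_add_left D C)) le_rfl)).mono le_rfl
      (affineUp_add hM C D _)
  inv_mem' := by
    rintro u ⟨C, hC⟩
    exact ⟨C, fun i => (hC i).inv⟩

instance (π : FreeGroup (Fin k) →* G) {M : ℕ → ℕ} (hM : Monotone M) (N : ι → ℕ) :
    (nullFam π hM N).Normal :=
  ⟨by rintro u ⟨C, hC⟩ v; exact ⟨C, fun i => (hC i).conj _⟩⟩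

/-- The families of words whose length is bounded linearly in the size. -/
def linFam (k : ℕ) (N : ι → ℕ) : Subgroup (ι → FreeGroup (Fin k)) where
  carrier := {u | ∃ C, ∀ i, (u i).norm ≤ C * N i + C}
  one_mem' := ⟨0, fun _ => by simp⟩
  mul_mem' := by
    rintro u v ⟨C, hC⟩ ⟨D, hD⟩
    refine ⟨C + D, fun i => (FreeGroup.norm_mul_le _ _).trans ?_⟩
    rw [add_mul]
    have := hC i
    have := hD i
    omega
  inv_mem' := by
    rintro u ⟨C, hC⟩
    exact ⟨C, fun i => by simpa using hC i⟩

theorem linFam_map {N : ι → ℕ} {u : ι → FreeGroup (Fin k)} (hu : u ∈ linFam k N)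
    (f : FreeGroup (Fin k) →* FreeGroup (Fin k')) : (fun i => f (u i)) ∈ linFam k' N := by
  obtain ⟨C, hC⟩ := hu
  obtain ⟨D, hD⟩ := FreeGroup.hom_norm_le f
  refine ⟨D * C, fun i => (hD _).trans ((Nat.mul_le_mul_left D (hC i)).trans_eq ?_)⟩
  ring

/-- Changing the word costs the image of a filling in the source group; changing the lift of the
homomorphism costs linearly many relators. -/
theorem div_mem_nullFam {M : ℕ → ℕ} (hM : Monotone M) {π : FreeGroup (Fin k) →* G}
    (hb : IsDehnBound π M) {π' : FreeGroup (Fin k') →* H} {θ : G →* H} {N : ι → ℕ}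
    {f f' : FreeGroup (Fin k) →* FreeGroup (Fin k')} (hf : ∀ u, π' (f u) = θ (π u))
    (hf' : ∀ u, π' (f' u) = θ (π u)) {w w' : ι → FreeGroup (Fin k)} (hw : w ∈ linFam k N)
    (hw' : w' ∈ linFam k N) (hww' : ∀ i, π (w i) = π (w' i)) :
    (fun i => f (w i) * (f' (w' i))⁻¹) ∈ nullFam π' hM N := by
  have h1 : (fun i => f (w i * (w' i)⁻¹)) ∈ nullFam π' hM N := by
    obtain ⟨C, hC⟩ := mul_mem hw (inv_mem hw')
    obtain ⟨C₀, hC₀⟩ := hb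
    obtain ⟨Cf, hCf⟩ := FreeGroup.hom_norm_le f
    obtain ⟨D, hD, -, hD'⟩ := affineUp_absorb hM C₀ (C + Cf * C₀ + 1)
    refine ⟨D, fun i => ?_⟩
    have h2 := (hC₀ (w i * (w' i)⁻¹) (by simp [hww'])).map f (S := relBall π' (Cf * C₀))
      fun r hr => ⟨by simp [hf, hr.1], (hCf r).trans (Nat.mul_le_mul_left _ hr.2)⟩
    refine h2.mono (relBall_mono _ (by omega)) (le_trans ?_ (hD' (N i)))
    set a := C + Cf * C₀ + 1 with ha
    have h3 : affineUp M C₀ (w i * (w' i)⁻¹).norm ≤ affineUp M C₀ (a * N i + a) :=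
      affineUp_mono hM le_rfl ((hC i).trans (by
        have := Nat.mul_le_mul_right (N i) (show C ≤ a by omega)
        omega))
    have h4 := Nat.le_mul_of_pos_left (affineUp M C₀ (a * N i + a)) (show 0 < a by omega)
    omega
  have h2 : (fun i => f (w' i) * (f' (w' i))⁻¹) ∈ nullFam π' hM N := by
    obtain ⟨C, hC⟩ := hw'
    obtain ⟨D, hD⟩ := exists_fillsIn_lift_div π' f f' fun u => by rw [hf, hf']
    refine ⟨D + C, fun i => (hD (w' i)).mono (relBall_mono _ (by omega)) ((hC i).trans ?_)⟩
    have := Nat.mul_le_mul_right (N i) (show C ≤ D + C by omega)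
    unfold affineUp
    omega
  convert mul_mem h1 h2 using 1
  funext i
  simp

/-- The families of elements that are represented by words of length bounded linearly in the size
act as if they were elements of a group: homomorphisms into `K` represent them in the group of all
families of words of `K` modulo the families with small fillings. -/
theorem exists_familyRep {K : Subgroup G} {M : ℕ → ℕ} (hM : Monotone M)
    {π : FreeGroup (Fin k) →* G} (hπ : Function.Surjective π) (hb : IsDehnBound π M)
    {π' : FreeGroup (Fin k') →* K} (hπ' : Function.Surjective π') (N : ι → ℕ) :
    ∃ S : FamilyRep K ι ((ι → FreeGroup (Fin k')) ⧸ nullFam π' hM N),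
      (∀ w ∈ linFam k N, (fun i => π (w i)) ∈ S.fam) ∧
      ∀ α : G →* G, (∀ x, α x ∈ K) → ∀ f : FreeGroup (Fin k) →* FreeGroup (Fin k'),
        (∀ u, (π' (f u) : G) = α (π u)) → ∀ w ∈ linFam k N, ∀ x : S.fam,
          (∀ i, x.1 i = π (w i)) → S.Θ α x = QuotientGroup.mk fun i => f (w i) := by
  classical
  let π₁ : (ι → FreeGroup (Fin k)) →* (ι → G) := π.compLeft ι
  let fam : Subgroup (ι → G) := (linFam k N).map π₁
  have hmem : ∀ w ∈ linFam k N, (fun i => π (w i)) ∈ fam := fun w hw => ⟨w, hw, rfl⟩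
  have hfam : ∀ x : fam, ∃ w ∈ linFam k N, ∀ i, x.1 i = π (w i) := by
    rintro ⟨_, w, hw, rfl⟩
    exact ⟨w, hw, fun _ => rfl⟩
  choose w₀ hw₀ hw₀' using hfam
  have hlift : ∀ α : G →* G, (∀ x, α x ∈ K) → ∃ f : FreeGroup (Fin k) →* FreeGroup (Fin k'),
      ∀ u, (π' (f u) : G) = α (π u) := fun α hα => by
    obtain ⟨f, hf⟩ := exists_lift π hπ' (α.codRestrict K hα)
    exact ⟨f, fun u => by rw [hf]; rfl⟩
  choose! f₀ hf₀ using hlift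
  have key : ∀ α : G →* G, (∀ x, α x ∈ K) → ∀ f f' : FreeGroup (Fin k) →* FreeGroup (Fin k'),
      (∀ u, (π' (f u) : G) = α (π u)) → (∀ u, (π' (f' u) : G) = α (π u)) →
      ∀ w ∈ linFam k N, ∀ w' ∈ linFam k N, (∀ i, π (w i) = π (w' i)) →
      (QuotientGroup.mk (fun i => f (w i)) : (ι → FreeGroup (Fin k')) ⧸ nullFam π' hM N) =
        QuotientGroup.mk fun i => f' (w' i) := by
    intro α hα f f' hf hf' w hw w' hw' hww'
    rw [eq_comm, QuotientGroup.eq_iff_div_mem, ← inv_mem_iff]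
    have := div_mem_nullFam hM hb (π' := π') (θ := α.codRestrict K hα) (f := f) (f' := f')
      (fun u => Subtype.ext (hf u)) (fun u => Subtype.ext (hf' u)) hw hw' hww'
    convert this using 1
    funext i
    simp [div_eq_mul_inv]
  -- The value for homomorphisms that leave `K` is a dummy: functoriality is only required when the
  -- outer homomorphism maps into `K`.
  let Θ : (G →* G) → fam →* (ι → FreeGroup (Fin k')) ⧸ nullFam π' hM N := fun α =>
    if hα : ∀ x, α x ∈ K then
      MonoidHom.mk' (fun x => QuotientGroup.mk fun i => f₀ α (w₀ x i)) fun x y => by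
        refine (key α hα (f₀ α) (f₀ α) (hf₀ α hα) (hf₀ α hα) _ (hw₀ (x * y)) _
          (mul_mem (hw₀ x) (hw₀ y)) fun i => ?_).trans ?_
        · rw [← hw₀']
          change x.1 i * y.1 i = _
          rw [hw₀' x, hw₀' y, ← map_mul]
          rfl
        · rw [← QuotientGroup.mk_mul]
          congr 1
          funext i
          simp
    else 1
  have hΘ : ∀ α : G →* G, (∀ x, α x ∈ K) → ∀ f : FreeGroup (Fin k) →* FreeGroup (Fin k'),
      (∀ u, (π' (f u) : G) = α (π u)) → ∀ w ∈ linFam k N, ∀ x : fam,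
      (∀ i, x.1 i = π (w i)) → Θ α x = QuotientGroup.mk fun i => f (w i) := by
    intro α hα f hf w hw x hx
    simp only [Θ, dif_pos hα, MonoidHom.mk'_apply]
    exact key α hα _ _ (hf₀ α hα) hf _ (hw₀ x) _ hw fun i => by rw [← hw₀', hx]
  have hη : ∀ η : G →* G, ∃ e : FreeGroup (Fin k) →* FreeGroup (Fin k), ∀ u, π (e u) = η (π u) :=
    fun η => exists_lift π hπ η
  refine ⟨⟨fam, ?_, Θ, ?_⟩, hmem, hΘ⟩
  · rintro η _ ⟨w, hw, rfl⟩
    obtain ⟨e, he⟩ := hη η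
    refine ⟨fun i => e (w i), linFam_map hw e, ?_⟩
    funext i
    exact he _
  · intro α η hα x
    obtain ⟨e, he⟩ := hη η
    rw [hΘ α hα (f₀ α) (hf₀ α hα) (fun i => e (w₀ x i)) (linFam_map (hw₀ x) e) _
      fun i => by rw [he, ← hw₀'],
      hΘ (α.comp η) (fun x => hα _) ((f₀ α).comp e) (fun u => by
        simp only [MonoidHom.comp_apply, hf₀ α hα, he]) (w₀ x) (hw₀ x) x (hw₀' x)]
    rfl

end asymptotic

/-! ### Triangles of normal forms -/

namespace SplitSystem

variable {A : Fin 4 → Type*} [∀ b, Group (A b)] {L : Bool → Type*} [∀ h, CommGroup (L h)]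
  (D : SplitSystem A L)

theorem pair_eq_self {i i' j k : Fin 4} (H : [i, i', j, k].Nodup) (h : Bool) {z : ∀ b, A b}
    (hz : z ∈ D.coabelian) (hj : z j = 1) (hk : z k = 1) : D.pair i i' h j k z = z := by
  have h1 : ∀ h, D.φ h i (z i) * D.φ h i' (z i') = 1 := fun h => by
    have := D.mem_coabelian.1 hz h
    rw [D.total_eq H, hj, hk] at this
    simpa using this
  funext c
  rw [pair_apply, h1, h1]
  rcases eq_or_of_nodup H c with rfl | rfl | rfl | rfl
  · simp
  · simp
  · simp [hj]
  · simp [hk]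

/-- Each `x` is `P x` times an element supported in the factors 2 and 3, which `P'` fixes. So the
images of `P` and `P'`, both finitely generated, generate. -/
theorem coabelian_fg [Group.FG (∀ b, A b)] : Group.FG D.coabelian := by
  have H : [(0 : Fin 4), 1, 2, 3].Nodup := by decide
  have H' : [(2 : Fin 4), 3, 0, 1].Nodup := by decide
  let P := (D.pair 0 1 true 2 3).codRestrict D.coabelian (D.pair_mem H true)
  let P' := (D.pair 2 3 true 0 1).codRestrict D.coabelian (D.pair_mem H' true)
  have h1 : P.range.FG := (Group.fg_iff_subgroup_fg _).1 inferInstance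
  have h2 : P'.range.FG := (Group.fg_iff_subgroup_fg _).1 inferInstance
  rw [Group.fg_def]
  convert h1.sup h2
  refine (eq_top_iff.2 fun x _ => ?_).symm
  have h3 : (P x)⁻¹ * x = P' ((P x)⁻¹ * x : D.coabelian) := by
    refine Subtype.ext (D.pair_eq_self H' true ((P x)⁻¹ * x).2 ?_ ?_).symm
    · change (D.pair 0 1 true 2 3 x 0)⁻¹ * x.1 0 = 1
      simp [pair_apply]
    · change (D.pair 0 1 true 2 3 x 1)⁻¹ * x.1 1 = 1
      simp [pair_apply]
  have h4 : x = P x * P' ((P x)⁻¹ * x : D.coabelian) := by rw [← h3, mul_inv_cancel_left]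
  rw [h4]
  exact Subgroup.mul_mem_sup ⟨_, rfl⟩ ⟨_, rfl⟩

/-- In the coabelian subgroup, triangles of normal forms have small area. -/
theorem exists_normalForm {M : ℕ → ℕ} (hM : Monotone M) (hG : DehnLE (∀ b, A b) M) :
    ∃ k, ∃ π : FreeGroup (Fin k) →* D.coabelian, Function.Surjective π ∧
      ∃ W : D.coabelian → FreeGroup (Fin k), (∀ x, π (W x) = x) ∧ W 1 = 1 ∧
      ∃ C, ∀ u v, FillsIn (relBall π C) (affineUp M C (u.norm + v.norm))
        (W (π u) * W (π v) * (W (π (u * v)))⁻¹) := by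
  have := hG.fg
  have := D.coabelian_fg
  have H : [(0 : Fin 4), 1, 2, 3].Nodup := by decide
  have H' : [(2 : Fin 4), 3, 0, 1].Nodup := by decide
  obtain ⟨k, π, hπ, hb⟩ := hG
  obtain ⟨k', π', hπ'⟩ := Group.FG.exists_surjective D.coabelian
  set P := D.pair 0 1 true 2 3 with hP
  set P' := D.pair 2 3 true 0 1 with hP'
  have hPm : ∀ g, P g ∈ D.coabelian := D.pair_mem H true
  have hPm' : ∀ g, P' g ∈ D.coabelian := D.pair_mem H' true
  obtain ⟨f, hf⟩ := exists_lift π hπ' (P.codRestrict D.coabelian hPm)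
  obtain ⟨f', hf'⟩ := exists_lift π hπ' (P'.codRestrict D.coabelian hPm')
  obtain ⟨d, hd⟩ := exists_lift π hπ P
  obtain ⟨e, he⟩ := exists_lift π' hπ D.coabelian.subtype
  obtain ⟨w, hw, hwmin, -⟩ := exists_words hπ
  have hw1 : w 1 = 1 := by simpa using hwmin 1
  have hlin : ∀ {ι : Type} (N : ι → ℕ) (u : ι → FreeGroup (Fin k)), u ∈ linFam k N →
      (fun i => w (π (u i))) ∈ linFam k N := fun N u ⟨C, hC⟩ =>
    ⟨C, fun i => (hwmin _).trans (hC i)⟩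
  let W : D.coabelian → FreeGroup (Fin k') := fun x => f (w x) * f' (w ((P x)⁻¹ * x))
  refine ⟨k', π', hπ', W, fun x => ?_, by simp [W, hw1], ?_⟩
  · refine Subtype.ext ?_
    simp only [W, map_mul, hf, hf', hw]
    change P x * (P' ((P x)⁻¹) * P' x) = x
    rw [← map_mul, D.pair_eq_self H' true (mul_mem (inv_mem (hPm _)) x.2), mul_inv_cancel_left]
    · simp [P, pair_apply]
    · simp [P, pair_apply]
  -- Indexing families by all pairs of words at once makes the constant in a statement about a
  -- single family uniform over all triangles.
  let ι := FreeGroup (Fin k') × FreeGroup (Fin k')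
  let N : ι → ℕ := fun p => p.1.norm + p.2.norm
  obtain ⟨S, hmem, hΘ⟩ := exists_familyRep hM hπ hb hπ' N
  have key : ∀ u : ι → FreeGroup (Fin k'), u ∈ linFam k' N → ∀ x : S.fam,
      (∀ i, x.1 i = (π' (u i) : ∀ b, A b)) → S.Θ P x * S.Θ P' ((S.push P x)⁻¹ * x) =
      QuotientGroup.mk fun i => W (π' (u i)) := by
    intro u hu x hx
    have hu' := linFam_map hu e
    have hxe : ∀ i, x.1 i = π (e (u i)) := fun i => by rw [he, hx]; rfl
    rw [hΘ P hPm f (fun u => by rw [hf]; rfl) _ (hlin N _ hu') x fun i => by rw [hw, hxe],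
      hΘ P' hPm' f' (fun u => by rw [hf']; rfl) _
        (hlin N _ (mul_mem (inv_mem (linFam_map hu' d)) hu')) ((S.push P x)⁻¹ * x) fun i => ?_]
    · rw [← QuotientGroup.mk_mul]
      congr 1
      funext i
      simp only [W, Pi.mul_apply, Pi.inv_apply, map_mul, map_inv, hd, he]
      rfl
    · rw [hw]
      simp only [Pi.mul_apply, Pi.inv_apply, map_mul, map_inv, hd, ← hxe]
      rfl
  have l1 : (fun p : ι => p.1) ∈ linFam k' N := ⟨1, fun p => by simp only [N]; omega⟩
  have l2 : (fun p : ι => p.2) ∈ linFam k' N := ⟨1, fun p => by simp only [N]; omega⟩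
  let x : S.fam := ⟨_, hmem _ (linFam_map l1 e)⟩
  let y : S.fam := ⟨_, hmem _ (linFam_map l2 e)⟩
  have hx : ∀ i, x.1 i = (π' i.1 : ∀ b, A b) := fun i => he _
  have hy : ∀ i, y.1 i = (π' i.2 : ∀ b, A b) := fun i => he _
  have e1 := S.normalForm_mul H true x y fun i => by rw [hx]; exact (π' i.1).2
  rw [key _ l1 x hx, key _ l2 y hy, key _ (mul_mem l1 l2) (x * y) fun i => by
    change x.1 i * y.1 i = _
    rw [hx, hy, Pi.mul_apply, map_mul]; rfl, ← QuotientGroup.mk_mul,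
    QuotientGroup.eq_iff_div_mem, ← inv_mem_iff] at e1
  obtain ⟨C, hC⟩ := e1
  refine ⟨C, fun u v => ?_⟩
  simpa [N, div_eq_mul_inv, mul_assoc] using hC (u, v)

end SplitSystem

/-! ### Dyadic subdivision of words -/

/-- The sum of the values of `T` at the lengths of the intervals of a dyadic subdivision. -/
def dyadic (T : ℕ → ℕ) (n : ℕ) : ℕ :=
  if n < 2 then 0 else dyadic T (n / 2) + dyadic T (n - n / 2) + T n
termination_by n
decreasing_by all_goals omega

theorem dyadic_of_lt (T : ℕ → ℕ) {n : ℕ} (h : n < 2) : dyadic T n = 0 := by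
  rw [dyadic, if_pos h]

theorem dyadic_of_le (T : ℕ → ℕ) {n : ℕ} (h : 2 ≤ n) :
    dyadic T n = dyadic T (n / 2) + dyadic T (n - n / 2) + T n := by
  rw [dyadic, if_neg (by omega)]

theorem dyadic_mono {T : ℕ → ℕ} (hT : Monotone T) : Monotone (dyadic T) := by
  have : ∀ n m, m ≤ n → dyadic T m ≤ dyadic T n := by
    intro n
    induction n using Nat.strong_induction_on with
    | _ n ih =>
      intro m hmn
      by_cases h : m < 2
      · rw [dyadic_of_lt T h]; exact Nat.zero_le _
      · rw [dyadic_of_le T (n := m) (by omega), dyadic_of_le T (n := n) (by omega)]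
        have h1 := ih (n / 2) (by omega) (m / 2) (by omega)
        have h2 := ih (n - n / 2) (by omega) (m - m / 2) (by omega)
        have h3 := hT hmn
        omega
  exact fun m n h => this n m h

/-- A word is filled by subdividing it dyadically, if triangles of normal forms can be filled. -/
theorem fillsIn_dyadic {k C c : ℕ} {K : Type*} [Group K] {π : FreeGroup (Fin k) →* K}
    {W : K → FreeGroup (Fin k)} (hW1 : W 1 = 1) {T : ℕ → ℕ} (hT : Monotone T)
    (htri : ∀ u v, FillsIn (relBall π C) (T (u.norm + v.norm))
      (W (π u) * W (π v) * (W (π (u * v)))⁻¹))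
    (hletter : ∀ L : List (Fin k × Bool), L.length = 1 →
      FillsIn (relBall π C) c (FreeGroup.mk L * (W (π (FreeGroup.mk L)))⁻¹)) :
    ∀ n (L : List (Fin k × Bool)), L.length = n → FillsIn (relBall π C) (c * n + dyadic T n)
      (FreeGroup.mk L * (W (π (FreeGroup.mk L)))⁻¹) := by
  intro n
  induction n using Nat.strong_induction_on with
  | _ n ih =>
    intro L hL
    rcases lt_or_ge n 2 with h | h
    · obtain rfl | rfl : n = 0 ∨ n = 1 := by omega
      · rw [List.eq_nil_of_length_eq_zero hL, ← FreeGroup.one_eq_mk, map_one, hW1]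
        simpa using FillsIn.one
      · exact (hletter L hL).mono le_rfl (by omega)
    · have e : L = L.take (n / 2) ++ L.drop (n / 2) := (List.take_append_drop _ _).symm
      have l1 : (L.take (n / 2)).length = n / 2 := by rw [List.length_take]; omega
      have l2 : (L.drop (n / 2)).length = n - n / 2 := by rw [List.length_drop]; omega
      have h1 := ih _ (by omega) _ l1
      have h2 := ih _ (by omega) _ l2
      -- Both halves are replaced by their normal forms, then one triangle merges them.
      have h3 := (h1.div_mul h2).div_trans (htri _ _)
      rw [FreeGroup.mul_mk, ← e] at h3
      refine h3.mono le_rfl ?_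
      have h4 := hT (Nat.add_le_add ((FreeGroup.norm_mk_le (L₁ := L.take (n / 2))).trans_eq l1)
        ((FreeGroup.norm_mk_le (L₁ := L.drop (n / 2))).trans_eq l2))
      rw [show n / 2 + (n - n / 2) = n by omega] at h4
      have h5 : c * n = c * (n / 2) + c * (n - n / 2) := by
        rw [← mul_add]; congr 1; omega
      rw [dyadic_of_le T h, h5]
      omega

theorem SplitSystem.dehnLE_coabelian {A : Fin 4 → Type*} [∀ b, Group (A b)] {L : Bool → Type*}
    [∀ h, CommGroup (L h)] (D : SplitSystem A L) {M : ℕ → ℕ} (hM : Monotone M)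
    (hG : DehnLE (∀ b, A b) M) : ∃ C, DehnLE D.coabelian (dyadic (affineUp M C)) := by
  obtain ⟨k, π, hπ, W, hW, hW1, C, hC⟩ := D.exists_normalForm hM hG
  have hT : Monotone (affineUp M C) := fun m n h => affineUp_mono hM le_rfl h
  have hfin : {L : List (Fin k × Bool) | L.length = 1}.Finite :=
    (List.finite_length_le _ 1).subset fun L hL => (show L.length = 1 from hL).le
  obtain ⟨C', hC'⟩ := (hfin.image fun L =>
    (FreeGroup.mk L * (W (π (FreeGroup.mk L)))⁻¹).norm).bddAbove
  have key := fillsIn_dyadic (π := π) (C := C + C') (c := 1) hW1 hT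
    (fun u v => (hC u v).mono (relBall_mono π (by omega)) le_rfl) fun L hL =>
      FillsIn.of_mem ⟨by simp [hW], (hC' ⟨L, hL, rfl⟩).trans (by omega)⟩
  refine ⟨C, k, π, hπ, C + C' + 1, fun u hu => ?_⟩
  have h1 := key _ u.toWord rfl
  rw [FreeGroup.mk_toWord, hu, hW1, inv_one, mul_one] at h1
  refine h1.mono (relBall_mono π (by omega)) ?_
  set a := C + C' + 1 with ha
  have h2 : dyadic (affineUp M C) u.norm ≤ dyadic (affineUp M C) (a * u.norm + a) :=
    dyadic_mono hT (by
      have := Nat.le_mul_of_pos_left u.norm (show 0 < a by omega)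
      omega)
  have h3 := Nat.le_mul_of_pos_left (dyadic (affineUp M C) (a * u.norm + a))
    (show 0 < a by omega)
  have h4 := Nat.le_mul_of_pos_left u.norm (show 0 < a by omega)
  unfold affineUp at *
  change 1 * u.norm + dyadic _ u.norm ≤ _
  omega

/-! ### Lower bound for the coabelian subgroup -/

namespace SplitSystem

variable {A : Fin 4 → Type*} [∀ b, Group (A b)] {L : Bool → Type*} [∀ h, CommGroup (L h)]
  (D : SplitSystem A L)

/-- The coabelian subgroup and the direct product contain two commuting elements that are
independent in the abelianization. -/
theorem sq_le (χ : L true →* Multiplicative ℤ) {v : L true} (hv : χ v = Multiplicative.ofAdd 1)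
    {Γ : Type*} [Group Γ] {j : Γ →* ∀ b, A b} (hj : Function.Injective j)
    (hD : ∀ x ∈ D.coabelian, ∃ y, j y = x) {M : ℕ → ℕ} (hM : Monotone M) (h : DehnLE Γ M) :
    ∃ C, ∀ n, n ^ 2 ≤ affineUp M C n := by
  let ψ : Fin 4 → Γ →* Multiplicative ℤ := fun i =>
    χ.comp ((D.φ true i).comp ((Pi.evalMonoidHom A i).comp j))
  -- `a` lives in the factors 0 and 2 and `b` in 1 and 3, so they commute; `χ` on the factors 0 and
  -- 1 tells them apart.
  obtain ⟨a, ha⟩ := hD (D.twist 0 true 2 3 (Pi.mulSingle 0 (D.t true 0 v)))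
    (D.twist_mem (i' := 1) (by decide) true _)
  obtain ⟨b, hb⟩ := hD (D.twist 1 true 3 2 (Pi.mulSingle 1 (D.t true 1 v)))
    (D.twist_mem (i' := 0) (by decide) true _)
  have ha' : ∀ c, j a c = if c = 0 then D.t true c v else if c = 2 then D.t true c v⁻¹ else 1 := by
    intro c
    rw [ha, twist_apply]
    fin_cases c <;> simp [D.φ_t, D.φ_not_t true]
  have hb' : ∀ c, j b c = if c = 1 then D.t true c v else if c = 3 then D.t true c v⁻¹ else 1 := by
    intro c
    rw [hb, twist_apply]
    fin_cases c <;> simp [D.φ_t, D.φ_not_t true]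
  refine h.sq_le hM (ψ 0) (ψ 1) (a := a) (b := b) (hj ?_) ?_ ?_ ?_ ?_
  · funext c
    rw [map_mul, map_mul, Pi.mul_apply, Pi.mul_apply, ha', hb']
    fin_cases c <;> simp
  · simp [ψ, ha', D.φ_t, hv]
  · simp [ψ, hb']
  · simp [ψ, ha']
  · simp [ψ, hb', D.φ_t, hv]

/-- The Dehn function of the direct product is at most that of the coabelian subgroup. -/
theorem dehnLE_pi [Group.FG (∀ b, A b)] (χ : L true →* Multiplicative ℤ) {v : L true}
    (hv : χ v = Multiplicative.ofAdd 1) {M : ℕ → ℕ} (hM : Monotone M)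
    (h : DehnLE D.coabelian M) : DehnLE (∀ b, A b) M := by
  have H : [(0 : Fin 4), 1, 2, 3].Nodup := by decide
  have H' : [(2 : Fin 4), 3, 0, 1].Nodup := by decide
  let block : Finset (Fin 4) → (∀ b, A b) →* (∀ b, A b) := fun s =>
    MonoidHom.pi fun c => if c ∈ s then Pi.evalMonoidHom A c else 1
  have hblock : ∀ s g c, block s g c = if c ∈ s then g c else 1 := by
    intro s g c
    simp only [block, MonoidHom.pi_apply]
    split_ifs <;> rfl
  -- Each projection to a pair of blocks factors through the coabelian subgroup: embed by `pair`,
  -- then forget the other two blocks.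
  refine DehnLE.of_commuting hM (D.sq_le χ hv (j := D.coabelian.subtype)
    Subtype.val_injective (fun x hx => ⟨⟨x, hx⟩, rfl⟩) hM h) (p := block {0, 1}) (q := block {2, 3})
    (fun x y => ?_) (fun x => ?_)
    h ((D.pair 0 1 true 2 3).codRestrict D.coabelian (D.pair_mem H true))
    ((block {0, 1}).comp D.coabelian.subtype) (fun x => ?_)
    h ((D.pair 2 3 true 0 1).codRestrict D.coabelian (D.pair_mem H' true))
    ((block {2, 3}).comp D.coabelian.subtype) (fun x => ?_)
  · funext c
    simp only [Pi.mul_apply, hblock]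
    fin_cases c <;> simp
  · funext c
    simp only [Pi.mul_apply, hblock]
    fin_cases c <;> simp
  · funext c
    change block {0, 1} (D.pair 0 1 true 2 3 x) c = _
    simp only [hblock, pair_apply]
    fin_cases c <;> simp
  · funext c
    change block {2, 3} (D.pair 2 3 true 0 1 x) c = _
    simp only [hblock, pair_apply]
    fin_cases c <;> simp

end SplitSystem

/-! ### Reduction to split systems by grouping factors -/

/-- The coordinate homomorphisms of a free abelian group. -/
def coordHom {X : Type*} (c : X) : Multiplicative (X → ℤ) →* Multiplicative ℤ :=
  (Pi.evalAddMonoidHom (fun _ => ℤ) c).toMultiplicative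

theorem coordHom_apply {X : Type*} (c : X) (v : Multiplicative (X → ℤ)) :
    coordHom c v = Multiplicative.ofAdd (v.toAdd c) := rfl

theorem toAdd_prod_apply {X I : Type*} (s : Finset I) (f : I → Multiplicative (X → ℤ)) (c : X) :
    (∏ i ∈ s, f i).toAdd c = ∑ i ∈ s, (f i).toAdd c := by
  rw [toAdd_prod, Finset.sum_apply]

/-- A common multiple of the basis vectors lies in all subgroups of a finite family of subgroups
of finite index. -/
theorem exists_single_mem {I X : Type*} [Fintype I] [DecidableEq X]
    (B : I → Subgroup (Multiplicative (X → ℤ))) (hB : ∀ i, (B i).FiniteIndex) :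
    ∃ d : ℕ, d ≠ 0 ∧ ∀ i c, Multiplicative.ofAdd (Pi.single c (d : ℤ)) ∈ B i := by
  refine ⟨∏ i, (B i).index, Finset.prod_ne_zero_iff.2 fun i _ => (hB i).index_ne_zero,
    fun i c => ?_⟩
  obtain ⟨e, he⟩ := Finset.dvd_prod_of_mem (fun i => (B i).index) (Finset.mem_univ i)
  have h1 := (B i).pow_mem ((B i).pow_index_mem (Multiplicative.ofAdd (Pi.single c (1 : ℤ)))) e
  rw [← pow_mul] at h1
  convert h1 using 1
  rw [he]
  refine Multiplicative.toAdd.injective ?_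
  rw [toAdd_pow, toAdd_ofAdd, toAdd_ofAdd, ← Pi.single_smul]
  simp

section blocks

variable {r l : ℕ} (G : Fin r → Type*) [∀ i, Group (G i)]
  (φ : (∀ i, G i) →* Multiplicative (Fin l → ℤ)) (d : ℕ)

/-- The coordinates of the restriction of `φ` to a factor. -/
def factorCoord (i : Fin r) (c : Fin l) : G i →* Multiplicative ℤ :=
  (coordHom c).comp (φ.comp (MonoidHom.mulSingle G i))

theorem coord_eq_prod (c : Fin l) (g : ∀ i, G i) :
    coordHom c (φ g) = ∏ i, factorCoord G φ i c (g i) := by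
  have : (coordHom c).comp φ = ∏ i, (factorCoord G φ i c).comp (Pi.evalMonoidHom G i) := by
    refine MonoidHom.pi_ext fun i x => ?_
    rw [MonoidHom.finsetProd_apply, Finset.prod_eq_single i]
    · simp [factorCoord]
    · intro b _ hb
      simp [hb]
    · simp
  have h := DFunLike.congr_fun this g
  rw [MonoidHom.finsetProd_apply] at h
  exact h

/-- The reduction of the coordinates modulo `d`. -/
def factorMod (i : Fin r) : G i →* (Fin l → Multiplicative (ZMod d)) :=
  MonoidHom.pi fun c =>
    ((Int.castAddHom (ZMod d)).toMultiplicative).comp (factorCoord G φ i c)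

theorem mem_ker_factorMod {i : Fin r} {x : G i} :
    x ∈ (factorMod G φ d i).ker ↔ ∀ c, (d : ℤ) ∣ (factorCoord G φ i c x).toAdd := by
  rw [MonoidHom.mem_ker, funext_iff]
  refine forall_congr' fun c => ?_
  rw [← ZMod.intCast_zmod_eq_zero_iff_dvd]
  rfl

/-- The coordinates divided by `d`, on the subgroup where they are divisible by `d`. -/
def dividedCoord (i : Fin r) (c : Fin l) : (factorMod G φ d i).ker →* Multiplicative ℤ :=
  MonoidHom.mk' (fun x => Multiplicative.ofAdd ((factorCoord G φ i c x).toAdd / d)) fun x y => by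
    have h := (mem_ker_factorMod G φ d).1 x.2 c
    simp only [Subgroup.coe_mul, map_mul, toAdd_mul]
    rw [Int.add_ediv_of_dvd_left h, ofAdd_add]

theorem dividedCoord_pow (i : Fin r) (c : Fin l) (x : (factorMod G φ d i).ker) :
    dividedCoord G φ d i c x ^ d = factorCoord G φ i c x := by
  refine Multiplicative.toAdd.injective ?_
  have h := (mem_ker_factorMod G φ d).1 x.2 c
  rw [toAdd_pow]
  simp only [dividedCoord, MonoidHom.mk'_apply, toAdd_ofAdd, nsmul_eq_mul]
  exact Int.mul_ediv_cancel' h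

end blocks

/-- The block of a factor, when the factors are divided into blocks of length `m`. -/
def blockOf {r : ℕ} (m : ℕ) (i : Fin r) : Fin 4 :=
  if i.1 < m then 0 else if i.1 < 2 * m then 1 else if i.1 < 3 * m then 2 else 3

theorem blockOf_eq {r m q : ℕ} (b : Fin 4) (hq : q < m) (i : Fin r) (hi : i.1 = b.1 * m + q) :
    blockOf m i = b := by
  unfold blockOf
  obtain ⟨b, hb⟩ := b
  change i.1 = b * m + q at hi
  interval_cases b
  · rw [if_pos (by omega)]; rfl
  · rw [if_neg (by omega), if_pos (by omega)]; rfl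
  · rw [if_neg (by omega), if_neg (by omega), if_pos (by omega)]; rfl
  · rw [if_neg (by omega), if_neg (by omega), if_neg (by omega)]; rfl

/-- Coordinates `c` and `c + m` share a position, so that `m` factors per block suffice; positions
are distinct only within each half. Surplus factors belong to the last block. -/
theorem exists_blockPos {r l m : ℕ} (hl : l ≤ 2 * m) (hr : 4 * m ≤ r) :
    ∃ pos : Fin 4 → Fin l → Fin r, (∀ b c, blockOf m (pos b c) = b) ∧
      ∀ b c c', decide (c.1 < m) = decide (c'.1 < m) → pos b c = pos b c' → c = c' := by
  have hq : ∀ c : Fin l, (if c.1 < m then c.1 else c.1 - m) < m := fun c => by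
    have := c.2
    split_ifs <;> omega
  refine ⟨fun b c => ⟨b.1 * m + if c.1 < m then c.1 else c.1 - m, ?_⟩, fun b c => ?_,
    fun b c c' h h' => ?_⟩
  · have h1 := hq c
    have h2 := Nat.mul_le_mul_right m (show b.1 ≤ 3 by omega)
    omega
  · exact blockOf_eq b (hq c) _ rfl
  · have h1 := congrArg Fin.val h'
    simp only [Nat.add_left_cancel_iff] at h1
    rw [decide_eq_decide] at h
    refine Fin.ext ?_
    split_ifs at h1 <;> omega

/-- Up to finite index, the kernel of `φ` is the coabelian subgroup of a split system whose
factors are products of blocks of the given factors. -/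
theorem exists_splitSystem.{u} {r l m : ℕ} (hl : 0 < l) (hlm : l ≤ 2 * m) (hr : 4 * m ≤ r)
    (G : Fin r → Type u) [∀ i, Group (G i)] (φ : (∀ i, G i) →* Multiplicative (Fin l → ℤ))
    (hφ : ∀ i, (φ.comp (MonoidHom.mulSingle G i)).range.FiniteIndex) :
    ∃ (A : Fin 4 → Type u) (_ : ∀ b, Group (A b)) (L : Bool → Type) (_ : ∀ h, CommGroup (L h))
      (D : SplitSystem A L), (∃ (χ : L true →* Multiplicative ℤ) (v : L true),
        χ v = Multiplicative.ofAdd 1) ∧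
      ∀ M : ℕ → ℕ, Monotone M → (DehnLE (∀ b, A b) M ↔ DehnLE (∀ i, G i) M) ∧
        (DehnLE D.coabelian M ↔ DehnLE φ.ker M) := by
  classical
  obtain ⟨d, hd, hdmem⟩ := exists_single_mem _ hφ
  have : NeZero d := ⟨hd⟩
  obtain ⟨pos, hpos, hinj⟩ := exists_blockPos hlm hr
  let G' : Fin r → Type _ := fun i => (factorMod G φ d i).ker
  let δ : ∀ i, Fin l → G' i →* Multiplicative ℤ := dividedCoord G φ d
  -- The image of each factor contains `d` times every basis vector, so after division by `d` every
  -- basis vector is attained.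
  have hτ : ∀ i c, ∃ x : G' i, ∀ c', (δ i c' x).toAdd = if c' = c then 1 else 0 := by
    intro i c
    obtain ⟨x, hx⟩ := hdmem i c
    have hx' : ∀ c', (factorCoord G φ i c' x).toAdd = if c' = c then (d : ℤ) else 0 := by
      intro c'
      change (coordHom c' ((φ.comp (MonoidHom.mulSingle G i)) x)).toAdd = _
      rw [hx, coordHom_apply]
      simp [Pi.single_apply]
    refine ⟨⟨x, (mem_ker_factorMod G φ d).2 fun c' => ?_⟩, fun c' => ?_⟩
    · rw [hx']
      split_ifs <;> simp
    · simp only [δ, dividedCoord, MonoidHom.mk'_apply, toAdd_ofAdd, hx']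
      split_ifs <;> simp [hd]
  choose τ hτ using hτ
  let A : Fin 4 → Type _ := fun b => ∀ i : {i : Fin r // blockOf m i = b}, G' i
  let X : Bool → Type := fun h => {c : Fin l // decide (c.1 < m) = h}
  let L : Bool → Type := fun h => Multiplicative (X h → ℤ)
  let Δ : ∀ h i, G' i →* L h := fun h i =>
    MonoidHom.mk' (fun x => Multiplicative.ofAdd fun c : X h => (δ i c.1 x).toAdd) fun x y => by
      refine Multiplicative.toAdd.injective (funext fun c => ?_)
      simp only [map_mul, toAdd_mul]
      rfl
  let Φ : ∀ h b, A b →* L h := fun h b =>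
    ∏ i : {i : Fin r // blockOf m i = b}, (Δ h i).comp (Pi.evalMonoidHom _ i)
  have hΦ : ∀ h b a c, (Φ h b a).toAdd c = ∑ i, (δ i.1 c.1 (a i)).toAdd := by
    intro h b a c
    simp only [Φ, MonoidHom.finsetProd_apply]
    exact toAdd_prod_apply _ _ _
  -- Each factor carries at most one coordinate of the half `h`, so its component is a power of a
  -- single element, and the components together form a homomorphism.
  let t' : ∀ h b, ∀ i : {i : Fin r // blockOf m i = b}, L h →* G' i := fun h b i =>
    if hx : ∃ c : X h, pos b c.1 = i then
      (zpowersHom (G' i) (τ i hx.choose.1)).comp (coordHom hx.choose) else 1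
  let t : ∀ h b, L h →* A b := fun h b => MonoidHom.pi (t' h b)
  have ht : ∀ h b v (c : X h), t h b v ⟨pos b c.1, hpos b c.1⟩ = τ _ c.1 ^ (v.toAdd c) := by
    intro h b v c
    have hx : ∃ c' : X h, pos b c'.1 = pos b c.1 := ⟨c, rfl⟩
    have hc : hx.choose = c := Subtype.ext (hinj b _ _
      (hx.choose.2.trans c.2.symm) hx.choose_spec)
    change t' h b ⟨pos b c.1, hpos b c.1⟩ v = _
    simp only [t']
    rw [dif_pos hx, hc]
    rfl
  have ht' : ∀ h b v i, (¬ ∃ c : X h, pos b c.1 = i.1) → t h b v i = 1 := by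
    intro h b v i hx
    change t' h b i v = 1
    simp only [t']
    rw [dif_neg hx]
    rfl
  have hδt : ∀ h b v i (c : Fin l), (δ i.1 c (t h b v i)).toAdd =
      if hc : decide (c.1 < m) = h ∧ pos b c = i.1 then v.toAdd ⟨c, hc.1⟩ else 0 := by
    intro h b v i c
    by_cases hx : ∃ c' : X h, pos b c'.1 = i.1
    · obtain ⟨c', hc'⟩ := hx
      obtain rfl : i = ⟨pos b c'.1, hpos b c'.1⟩ := Subtype.ext hc'.symm
      rw [ht, map_zpow, toAdd_zpow, hτ]
      by_cases hcc : c = c'.1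
      · subst hcc
        rw [dif_pos ⟨c'.2, rfl⟩]
        simp
      · rw [dif_neg fun h1 => hcc (hinj b _ _ (h1.1.trans c'.2.symm) h1.2)]
        simp [hcc]
    · rw [ht' h b v i hx, map_one, dif_neg fun h1 => hx ⟨⟨c, h1.1⟩, h1.2⟩]
      rfl
  let D : SplitSystem A L :=
    { φ := Φ
      t := t
      φ_t := fun h b v => by
        refine Multiplicative.toAdd.injective (funext fun c => ?_)
        rw [hΦ, Finset.sum_eq_single ⟨pos b c.1, hpos b c.1⟩]
        · rw [hδt, dif_pos ⟨c.2, rfl⟩]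
        · intro i _ hi
          rw [hδt, dif_neg fun h1 => hi (Subtype.ext h1.2.symm)]
        · simp
      φ_t_not := fun h b v => by
        refine Multiplicative.toAdd.injective (funext fun c => ?_)
        rw [hΦ]
        refine Finset.sum_eq_zero fun i _ => ?_
        rw [hδt, dif_neg fun h1 => ?_]
        have := c.2.symm.trans h1.1
        cases h <;> simp at this }
  let J : (∀ b, A b) →* ∀ i, G i := MonoidHom.pi fun i =>
    (factorMod G φ d i).ker.subtype.comp
      ((Pi.evalMonoidHom (fun i : {j // blockOf m j = blockOf m i} => G' i) ⟨i, rfl⟩).comp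
        (Pi.evalMonoidHom A (blockOf m i)))
  have hJ : ∀ a i, J a i = (a (blockOf m i) ⟨i, rfl⟩ : G' i).1 := fun _ _ => rfl
  have hJinj : Function.Injective J := by
    intro a a' h
    funext b ⟨i, hi⟩
    subst hi
    refine Subtype.ext ?_
    rw [← hJ, ← hJ, h]
  have hJmem : ∀ g : ∀ i, G i, (∀ i, g i ∈ (factorMod G φ d i).ker) → ∃ a, J a = g :=
    fun g hg => ⟨fun b i => ⟨g i.1, hg i.1⟩, rfl⟩
  have hJfi : J.range.FiniteIndex := by
    -- The range of `J` contains the kernel of this map to a finite group.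
    let F : (∀ i, G i) →* ∀ _ : Fin r, Fin l → Multiplicative (ZMod d) :=
      MonoidHom.pi fun i => (factorMod G φ d i).comp (Pi.evalMonoidHom G i)
    have : Finite (Multiplicative (ZMod d)) := inferInstanceAs (Finite (ZMod d))
    have : F.ker.FiniteIndex := inferInstance
    refine Subgroup.finiteIndex_of_le (H := F.ker) fun g hg => ?_
    exact hJmem g fun i => congrFun hg i
  have htotal : ∀ h a (c : X h), coordHom c.1 (φ (J a)) =
      Multiplicative.ofAdd ((D.total h a).toAdd c) ^ d := by
    intro h a c
    rw [coord_eq_prod, D.total_apply]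
    refine Multiplicative.toAdd.injective ?_
    rw [toAdd_pow, toAdd_ofAdd, toAdd_prod, toAdd_prod, Finset.sum_apply]
    have h1 : ∀ i, (factorCoord G φ i c.1 (J a i)).toAdd =
        d • (δ i c.1 (a (blockOf m i) ⟨i, rfl⟩)).toAdd := fun i => by
      rw [hJ, ← dividedCoord_pow, toAdd_pow]
    have h2 : ∀ b, (D.φ h b (a b)).toAdd c = ∑ i, (δ i.1 c.1 (a b i)).toAdd := fun b => hΦ h b _ c
    simp only [h1, h2, ← Finset.smul_sum]
    congr 1
    rw [← Fintype.sum_sigma' (fun b (i : {i // blockOf m i = b}) => (δ i.1 c.1 (a b i)).toAdd)]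
    refine (Fintype.sum_equiv (Equiv.sigmaFiberEquiv (blockOf m)) _ _ ?_).symm
    rintro ⟨b, i, rfl⟩
    rfl
  have hker : ∀ a, a ∈ D.coabelian ↔ J a ∈ φ.ker := by
    intro a
    rw [D.mem_coabelian, MonoidHom.mem_ker]
    constructor
    · intro h
      refine Multiplicative.toAdd.injective (funext fun c => ?_)
      have h1 := htotal (decide (c.1 < m)) a ⟨c, rfl⟩
      rw [h, coordHom_apply] at h1
      simpa using h1
    · intro h h'
      refine Multiplicative.toAdd.injective (funext fun c => ?_)
      have h1 := htotal h' a c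
      rw [h, map_one, ← ofAdd_nsmul, eq_comm, ofAdd_eq_one, smul_eq_zero] at h1
      exact h1.resolve_left hd
  let j : D.coabelian →* φ.ker :=
    (J.comp D.coabelian.subtype).codRestrict φ.ker fun a => (hker a).1 a.2
  have hjinj : Function.Injective j := fun a a' h =>
    Subtype.ext (hJinj (congrArg Subtype.val h))
  have hjfi : j.range.FiniteIndex := by
    refine Subgroup.finiteIndex_of_le (H := J.range.subgroupOf φ.ker) ?_
    rintro ⟨x, hx⟩ ⟨a, rfl⟩
    exact ⟨⟨a, (hker a).2 hx⟩, rfl⟩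
  refine ⟨A, inferInstance, L, inferInstance, D, ?_, fun M hM =>
    ⟨dehnLE_iff_of_finiteIndex hJinj hJfi hM, dehnLE_iff_of_finiteIndex hjinj hjfi hM⟩⟩
  have hm : 0 < m := by omega
  exact ⟨coordHom ⟨⟨0, hl⟩, by simpa using hm⟩, Multiplicative.ofAdd fun _ => 1, rfl⟩

/-! ### Comparison of growth functions -/

theorem AsympLE.trans {f g h : ℕ → ℝ} (hfg : AsympLE f g) (hgh : AsympLE g h) (hm : Monotone h)
    (h0 : ∀ n, 0 ≤ h n) : AsympLE f h := by
  obtain ⟨C, hC, hfg⟩ := hfg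
  obtain ⟨B, hB, hgh⟩ := hgh
  refine ⟨C * B + C * B * C + C * B + B * C + B + C, by positivity, fun n => ?_⟩
  set E := C * B + C * B * C + C * B + B * C + B + C with hE
  have h1 : (g (C * n + C) : ℝ) ≤ B * h (B * (C * n + C) + B) + B * ((C * n + C : ℕ) : ℝ) + B :=
    hgh _
  have h2 : h (B * (C * n + C) + B) ≤ h (E * n + E) := by
    refine hm ?_
    have h3 : B * (C * n + C) + B = B * C * n + (B * C + B) := by ring
    have h4 : B * C * n ≤ E * n := Nat.mul_le_mul_right _ (by omega)
    omega
  have h5 : (C : ℝ) * B ≤ E := by exact_mod_cast (by omega : C * B ≤ E)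
  have h6 : (C : ℝ) * B * C + C ≤ E := by exact_mod_cast (by omega : C * B * C + C ≤ E)
  have h7 : (C : ℝ) * B * C + C * B + C ≤ E := by
    exact_mod_cast (by omega : C * B * C + C * B + C ≤ E)
  have hn : (0 : ℝ) ≤ n := Nat.cast_nonneg n
  push_cast at h1
  calc f n ≤ C * g (C * n + C) + C * n + C := hfg n
    _ ≤ C * (B * h (B * (C * n + C) + B) + B * (C * n + C) + B) + C * n + C := by gcongr
    _ = C * B * h (B * (C * n + C) + B) + (C * B * C + C) * n + (C * B * C + C * B + C) := by ring
    _ ≤ E * h (E * n + E) + E * n + E := by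
      have h8 := h0 (E * n + E)
      have h9 := h0 (B * (C * n + C) + B)
      gcongr

theorem asympLE_affineUp {M : ℕ → ℕ} (hM : Monotone M) (C : ℕ) :
    AsympLE (fun n => (affineUp M C n : ℝ)) (fun n => (M n : ℝ)) := by
  refine ⟨C + 1, by omega, fun n => ?_⟩
  have h := affineUp_mono hM (Nat.le_add_right C 1) (le_refl n)
  have h' : (affineUp M C n : ℝ) ≤ (affineUp M (C + 1) n : ℝ) := by exact_mod_cast h
  refine h'.trans (le_of_eq ?_)
  simp [affineUp]

section growth

variable {f : ℕ → ℝ} (hf0 : ∀ n, 0 ≤ f n) (hfm : Monotone f)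
include hf0 hfm

/-- A quadratic lower bound lets `f` absorb linear terms, so that the bounds fed into dyadic sums
carry no affine error. -/
theorem exists_le_of_sq_asympLE (h : AsympLE (fun n => (n : ℝ) ^ 2) f) :
    ∃ C : ℕ, 0 < C ∧ ∀ n : ℕ, 1 ≤ n → (n : ℝ) ≤ C * f (C * n) := by
  obtain ⟨E, hE, h⟩ := h
  refine ⟨5 * E ^ 2, by positivity, fun n hn => ?_⟩
  -- At `4 * E * n` the square dominates the affine error terms of the hypothesis.
  have h1 := h (4 * E * n)
  have h2 : f (E * (4 * E * n) + E) ≤ f (5 * E ^ 2 * n) := hfm (by nlinarith)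
  have hE' : (1 : ℝ) ≤ E := by exact_mod_cast hE
  have hn' : (1 : ℝ) ≤ n := by exact_mod_cast hn
  have h3 := hf0 (5 * E ^ 2 * n)
  push_cast at h1 ⊢
  have h4 : (E : ℝ) * f (E * (4 * E * n) + E) ≤ 5 * E ^ 2 * f (5 * E ^ 2 * n) :=
    mul_le_mul (by nlinarith) h2 (hf0 _) (by positivity)
  have h5 : (1 : ℝ) ≤ E * n := by nlinarith
  have h6 : (n : ℝ) ≤ (E * n) * (E * n) := by nlinarith
  have h7 : (E : ℝ) ≤ (E * n) * E := by nlinarith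
  have h8 : (E : ℝ) * (E * n) ≤ (E * n) * (E * n) := by nlinarith
  nlinarith

theorem AsympLE.exists_le {T : ℕ → ℝ} (hT : AsympLE T f) {C : ℕ}
    (hC : ∀ n : ℕ, 1 ≤ n → (n : ℝ) ≤ C * f (C * n)) :
    ∃ B : ℕ, 0 < B ∧ ∀ n : ℕ, 1 ≤ n → T n ≤ B * f (B * n) := by
  obtain ⟨B, hB, hT⟩ := hT
  refine ⟨2 * B + 2 * B * C + C, by positivity, fun n hn => ?_⟩
  set E := 2 * B + 2 * B * C + C with hE
  have h1 : f (B * n + B) ≤ f (E * n) := by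
    have h2 : B * 1 ≤ B * n := Nat.mul_le_mul_left B hn
    have h3 : 2 * B * n ≤ E * n := Nat.mul_le_mul_right n (by omega)
    exact hfm (by linarith)
  have h2 : f (C * n) ≤ f (E * n) := hfm (Nat.mul_le_mul_right _ (by omega))
  have hn' : (1 : ℝ) ≤ n := by exact_mod_cast hn
  have hB' : (0 : ℝ) ≤ B := Nat.cast_nonneg B
  have hC' : (0 : ℝ) ≤ C := Nat.cast_nonneg C
  have h0 := hf0 (E * n)
  have h3 : (n : ℝ) ≤ C * f (E * n) := (hC n hn).trans (mul_le_mul_of_nonneg_left h2 hC')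
  have h4 := mul_le_mul_of_nonneg_left h1 hB'
  have h5 := mul_le_mul_of_nonneg_left h3 hB'
  have h6 : (E : ℝ) = 2 * B + 2 * B * C + C := by rw [hE]; push_cast; ring
  have h7 : (B : ℝ) ≤ B * n := by nlinarith
  have h8 : 0 ≤ B * f (E * n) := mul_nonneg hB' h0
  have h9 : 0 ≤ C * f (E * n) := mul_nonneg hC' h0
  have h10 := hT n
  rw [h6]
  nlinarith

end growth

theorem Superadditive.le_of_le {g : ℕ → ℝ} (hg : Superadditive g) (h0 : ∀ n, 0 ≤ g n) {m n : ℕ}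
    (hm : 0 < m) (hmn : m ≤ n) : g m ≤ g n := by
  rcases hmn.eq_or_lt with rfl | h
  · exact le_rfl
  · have h1 := hg m (n - m) hm (by omega)
    rw [show m + (n - m) = n by omega] at h1
    have := h0 (n - m)
    linarith

theorem clog_two_le {n : ℕ} (hn : 1 ≤ n) : (Nat.clog 2 n : ℝ) ≤ 2 * Real.log (2 * n) := by
  have hn' : (1 : ℝ) ≤ n := by exact_mod_cast hn
  have h1 : (2 : ℝ) ^ Nat.clog 2 n ≤ 2 * n := by
    rcases hn.eq_or_lt with rfl | h
    · simp
    · have h2 := Nat.pow_pred_clog_lt_self (b := 2) (by norm_num) h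
      have h3 : Nat.clog 2 n = (Nat.clog 2 n).pred + 1 := by
        have := Nat.clog_pos (b := 2) (by norm_num) (show 2 ≤ n from h)
        simp only [Nat.pred_eq_sub_one]
        omega
      rw [h3, pow_succ]
      have h4 : (2 : ℝ) ^ (Nat.clog 2 n).pred ≤ n := by exact_mod_cast h2.le
      linarith
  have h2 := Real.log_le_log (by positivity) h1
  rw [Real.log_pow] at h2
  have h3 : (0 : ℝ) ≤ Nat.clog 2 n := Nat.cast_nonneg _
  have h4 := Real.log_two_gt_d9
  nlinarith

/-- Dyadic sums of a function bounded by a superadditive function. -/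
theorem dyadic_le_clog {T : ℕ → ℕ} {g : ℕ → ℝ} (hg : Superadditive g) (h0 : ∀ n, 0 ≤ g n) {B : ℕ}
    (hB : 0 < B) (hT : ∀ n, 1 ≤ n → (T n : ℝ) ≤ B * g (B * n)) :
    ∀ n, 1 ≤ n → (dyadic T n : ℝ) ≤ Nat.clog 2 n * (B * g (B * n)) := by
  intro n
  induction n using Nat.strong_induction_on with
  | _ n ih =>
    intro hn
    rcases lt_or_ge n 2 with h | h
    · rw [dyadic_of_lt T h, Nat.cast_zero]
      have := h0 (B * n)
      positivity
    · have h1 := ih (n / 2) (by omega) (by omega)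
      have h2 := ih (n - n / 2) (by omega) (by omega)
      have h3 : Nat.clog 2 n = Nat.clog 2 (n - n / 2) + 1 := by
        rw [Nat.clog_of_two_le (by norm_num) h, show (n + 2 - 1) / 2 = n - n / 2 by omega]
      have h4 : Nat.clog 2 (n / 2) ≤ Nat.clog 2 (n - n / 2) := Nat.clog_mono_right 2 (by omega)
      have h5 := hg (B * (n / 2)) (B * (n - n / 2)) (Nat.mul_pos hB (by omega))
        (Nat.mul_pos hB (by omega))
      rw [← mul_add, show n / 2 + (n - n / 2) = n by omega] at h5
      have h6 : (Nat.clog 2 (n / 2) : ℝ) ≤ Nat.clog 2 (n - n / 2) := by exact_mod_cast h4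
      have hB' : (0 : ℝ) ≤ B := Nat.cast_nonneg B
      rw [dyadic_of_le T h, h3]
      push_cast
      have h7 := hT n hn
      have h8 := mul_le_mul_of_nonneg_right h6 (mul_nonneg hB' (h0 (B * (n / 2))))
      have h9 := mul_le_mul_of_nonneg_left (mul_le_mul_of_nonneg_left h5 hB')
        (Nat.cast_nonneg (α := ℝ) (Nat.clog 2 (n - n / 2)))
      nlinarith

theorem log_mul_monotone {g : ℕ → ℝ} (hg : Superadditive g) (h0 : ∀ n, 0 ≤ g n) :
    Monotone fun n : ℕ => Real.log n * g n := by
  intro m n hmn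
  rcases Nat.eq_zero_or_pos m with rfl | hm
  -- At zero, `Real.log 0 = 0` settles the matter; superadditivity says nothing about `g 0`.
  · simpa using mul_nonneg (Real.log_natCast_nonneg n) (h0 n)
  · have h1 : Real.log m ≤ Real.log n :=
      Real.log_le_log (by exact_mod_cast hm) (by exact_mod_cast hmn)
    exact mul_le_mul h1 (hg.le_of_le h0 hm hmn) (h0 m) (Real.log_natCast_nonneg n)

theorem dyadic_asympLE_log {T : ℕ → ℕ} {g : ℕ → ℝ} (hg : Superadditive g) (h0 : ∀ n, 0 ≤ g n)
    {B : ℕ} (hB : 0 < B) (hT : ∀ n, 1 ≤ n → (T n : ℝ) ≤ B * g (B * n)) :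
    AsympLE (fun n => (dyadic T n : ℝ)) fun n => Real.log n * g n := by
  refine ⟨2 * B, by omega, fun n => ?_⟩
  set E := 2 * B with hE
  have hpos : 0 ≤ Real.log ((E * n + E : ℕ) : ℝ) * g (E * n + E) :=
    mul_nonneg (Real.log_natCast_nonneg _) (h0 _)
  have hEn : (0 : ℝ) ≤ E * n + E := by positivity
  suffices h : (dyadic T n : ℝ) ≤ E * (Real.log ((E * n + E : ℕ) : ℝ) * g (E * n + E)) by
    linarith
  rcases Nat.eq_zero_or_pos n with rfl | hn
  · rw [dyadic_of_lt T (by norm_num), Nat.cast_zero]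
    positivity
  have h1 := dyadic_le_clog hg h0 hB hT n hn
  have h2 : g (B * n) ≤ g (E * n + E) := by
    refine hg.le_of_le h0 (Nat.mul_pos hB hn) ?_
    have := Nat.mul_le_mul_right n (show B ≤ E by omega)
    omega
  have h3 : Real.log (2 * n) ≤ Real.log ((E * n + E : ℕ) : ℝ) := by
    refine Real.log_le_log (by positivity) ?_
    have := Nat.mul_le_mul_right n (show 2 ≤ E by omega)
    exact_mod_cast (show 2 * n ≤ E * n + E by omega)
  have h4 := (clog_two_le hn).trans (mul_le_mul_of_nonneg_left h3 zero_le_two)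
  have hB' : (0 : ℝ) ≤ B := Nat.cast_nonneg B
  calc (dyadic T n : ℝ) ≤ Nat.clog 2 n * (B * g (B * n)) := h1
    _ ≤ (2 * Real.log ((E * n + E : ℕ) : ℝ)) * (B * g (E * n + E)) :=
      mul_le_mul h4 (mul_le_mul_of_nonneg_left h2 hB') (mul_nonneg hB' (h0 _))
        (mul_nonneg zero_le_two (Real.log_natCast_nonneg _))
    _ = E * (Real.log ((E * n + E : ℕ) : ℝ) * g (E * n + E)) := by
      rw [hE]; push_cast; ring

/-- Dyadic sums of a function bounded by `f`, where `f n / n` is superadditive. -/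
theorem dyadic_le_of_superadditive_div {T : ℕ → ℕ} {f : ℕ → ℝ} (h0 : ∀ n, 0 ≤ f n)
    (hf : Superadditive fun n => f n / n) {B : ℕ} (hB : 0 < B)
    (hT : ∀ n, 1 ≤ n → (T n : ℝ) ≤ B * f (B * n)) :
    ∀ n, 1 ≤ n → (dyadic T n : ℝ) ≤ 3 * B * f (B * n) := by
  have hB' : (0 : ℝ) < B := by exact_mod_cast hB
  let g : ℕ → ℝ := fun n => f (B * n) / ((B * n : ℕ) : ℝ)
  have hg0 : ∀ n, 0 ≤ g n := fun n => div_nonneg (h0 _) (Nat.cast_nonneg _)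
  have hfg : ∀ n, 1 ≤ n → f (B * n) = B * n * g n := fun n hn => by
    have : (n : ℝ) ≠ 0 := by positivity
    simp only [g]
    push_cast
    field_simp
  intro n
  induction n using Nat.strong_induction_on with
  | _ n ih =>
    intro hn
    rcases lt_or_ge n 2 with h | h
    · rw [dyadic_of_lt T h, Nat.cast_zero]
      have := h0 (B * n)
      positivity
    -- The larger half is at most two thirds of `n`, with equality at `n = 3`.
    · obtain ⟨a, b, ha, hb, hab, hn', hdy⟩ : ∃ a b, 1 ≤ a ∧ 1 ≤ b ∧ a ≤ b ∧ (n = a + b ∧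
          3 * b ≤ 2 * n) ∧ dyadic T n = dyadic T a + dyadic T b + T n :=
        ⟨n / 2, n - n / 2, by omega, by omega, by omega, by omega, dyadic_of_le T h⟩
      obtain ⟨rfl, hb2⟩ := hn'
      have h1 := ih a (by omega) ha
      have h2 := ih b (by omega) hb
      have h3 := hT (a + b) hn
      have h4 : g a + g b ≤ g (a + b) := by
        have := hf (B * a) (B * b) (Nat.mul_pos hB ha) (Nat.mul_pos hB hb)
        rw [← mul_add] at this
        exact this
      have hab' : (a : ℝ) ≤ b := by exact_mod_cast hab
      have hb2' : 3 * (b : ℝ) ≤ 2 * (a + b) := by exact_mod_cast hb2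
      -- Each level costs at most two thirds of the one above; the geometric series gives the factor
      -- 3.
      have h5 : f (B * a) + f (B * b) ≤ 2 / 3 * f (B * (a + b)) := by
        rw [hfg a ha, hfg b hb, hfg (a + b) hn]
        push_cast
        have e1 : (B : ℝ) * a * g a ≤ B * b * g a := by
          have := hg0 a
          gcongr
        have e2 : (B : ℝ) * b * (g a + g b) ≤ B * b * g (a + b) := by gcongr
        have e3 : (B : ℝ) * (3 * b) * g (a + b) ≤ B * (2 * (a + b)) * g (a + b) := by
          have := hg0 (a + b)
          gcongr
        linarith
      have h6 := mul_le_mul_of_nonneg_left h5 hB'.le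
      rw [hdy]
      push_cast
      linarith

theorem dyadic_asympLE_of_superadditive_div {T : ℕ → ℕ} {f : ℕ → ℝ} (h0 : ∀ n, 0 ≤ f n)
    (hfm : Monotone f) (hf : Superadditive fun n => f n / n) {B : ℕ} (hB : 0 < B)
    (hT : ∀ n, 1 ≤ n → (T n : ℝ) ≤ B * f (B * n)) :
    AsympLE (fun n => (dyadic T n : ℝ)) f := by
  refine ⟨3 * B, by omega, fun n => ?_⟩
  have h1 := h0 (3 * B * n + 3 * B)
  rcases Nat.eq_zero_or_pos n with rfl | hn
  · change (dyadic T 0 : ℝ) ≤ _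
    rw [dyadic_of_lt T (by norm_num), Nat.cast_zero]
    positivity
  have h2 : f (B * n) ≤ f (3 * B * n + 3 * B) := hfm (by nlinarith)
  have h3 := dyadic_le_of_superadditive_div h0 hf hB hT n hn
  have h4 : 3 * (B : ℝ) * f (B * n) ≤ 3 * B * f (3 * B * n + 3 * B) := by gcongr
  have h5 : (0 : ℝ) ≤ 3 * B * n + 3 * B := by positivity
  push_cast
  linarith

theorem asympLE_log_mul {f g : ℕ → ℝ} (h0 : ∀ n, 0 ≤ f n) (hfm : Monotone f) (hfg : f ≤ g) :
    AsympLE f fun n => Real.log n * g n := by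
  -- The constant 3 ensures that the logarithm at `3 * n + 3` is at least 1.
  refine ⟨3, by norm_num, fun n => ?_⟩
  have h1 : f n ≤ g (3 * n + 3) := (hfm (by omega)).trans (hfg _)
  have h2 : 1 ≤ Real.log ((3 * n + 3 : ℕ) : ℝ) := by
    rw [Real.le_log_iff_exp_le (by positivity)]
    have h3 : (3 : ℝ) ≤ ((3 * n + 3 : ℕ) : ℝ) := by exact_mod_cast (by omega : 3 ≤ 3 * n + 3)
    exact Real.exp_one_lt_three.le.trans h3
  have h4 : 0 ≤ g (3 * n + 3) := (h0 _).trans (hfg _)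
  have h5 : (0 : ℝ) ≤ n := Nat.cast_nonneg n
  push_cast at *
  nlinarith [mul_le_mul_of_nonneg_right h2 h4]

/-! ### The main theorem -/

theorem mainTheorem6 {r l : ℕ} (hr : 3 ≤ r)
    (G : Fin r → Type*) [∀ i, Group (G i)] (hG : ∀ i, Group.IsFinitelyPresented (G i))
    (φ : (∀ i, G i) →* Multiplicative (Fin l → ℤ))
    (hφ : ∀ i, (φ.comp (MonoidHom.mulSingle G i)).range.FiniteIndex)
    (hl : (⌈(l : ℝ) / 2⌉ : ℝ) ≤ (r : ℝ) / 4) :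
    Group.IsFinitelyPresented φ.ker ∧
    ∀ (P : FinitePresentation (∀ i, G i)) (Q : FinitePresentation φ.ker)
      (f : ℕ → ℝ), (∀ n, 0 ≤ f n) → Monotone f → AsympEq f (fun n => (P.dehn n : ℝ)) →
      AsympLE f (fun n => (Q.dehn n : ℝ)) ∧
      AsympLE (fun n => (Q.dehn n : ℝ)) (fun n => Real.log n * superadditiveClosure f n) ∧
      (Superadditive (fun n => f n / n) → AsympEq (fun n => (Q.dehn n : ℝ)) f) := by
  obtain ⟨M₀, hM₀, hGM₀⟩ := exists_dehnLE_pi G hG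
  have hcast : ∀ {Γ : Type _} [Group Γ] (Q : FinitePresentation Γ),
      Monotone fun n => (Q.dehn n : ℝ) := fun Q m n h => Nat.cast_le.2 (Q.dehn_mono h)
  rcases Nat.eq_zero_or_pos l with rfl | hl0
  -- For `l = 0` the kernel is the whole product.
  · have hker : ∀ g, g ∈ φ.ker := fun g =>
      MonoidHom.mem_ker.2 (Multiplicative.toAdd.injective (Subsingleton.elim _ _))
    let s : (∀ i, G i) →* φ.ker := (MonoidHom.id _).codRestrict φ.ker hker
    have down : ∀ M : ℕ → ℕ, Monotone M → DehnLE (∀ i, G i) M → DehnLE φ.ker M :=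
      fun M hM h => h.of_retract hM φ.ker.subtype s fun _ => rfl
    have up : ∀ M : ℕ → ℕ, Monotone M → DehnLE φ.ker M → DehnLE (∀ i, G i) M :=
      fun M hM h => h.of_retract hM s φ.ker.subtype fun _ => rfl
    refine ⟨(down _ hM₀ hGM₀).isFinitelyPresented, fun P Q f hf0 hfm hfP => ?_⟩
    have hcl := superadditiveClosure_isLeast f
    have hcl0 : ∀ n, 0 ≤ superadditiveClosure f n := fun n => (hf0 n).trans (hcl.1.2 n)
    have h1 : AsympLE f (fun n => (Q.dehn n : ℝ)) :=
      hfP.1.trans ((up _ Q.dehn_mono Q.dehnLE).asympLE Q.dehn_mono P) (hcast Q)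
        fun n => Nat.cast_nonneg _
    have h2 : AsympLE (fun n => (Q.dehn n : ℝ)) f :=
      ((down _ P.dehn_mono P.dehnLE).asympLE P.dehn_mono Q).trans hfP.2 hfm hf0
    exact ⟨h1, h2.trans (asympLE_log_mul hf0 hfm hcl.1.2) (log_mul_monotone hcl.1.1 hcl0)
      fun n => mul_nonneg (Real.log_natCast_nonneg n) (hcl0 n), fun _ => ⟨h2, h1⟩⟩
  · obtain ⟨m, hlm, hmr⟩ : ∃ m, l ≤ 2 * m ∧ 4 * m ≤ r := by
      refine ⟨(l + 1) / 2, by omega, ?_⟩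
      have h1 : (l : ℝ) ≤ 2 * ⌈(l : ℝ) / 2⌉ := by linarith [Int.le_ceil ((l : ℝ) / 2)]
      have h2 : 4 * (⌈(l : ℝ) / 2⌉ : ℝ) ≤ r := by linarith
      have h3 : (l : ℤ) ≤ 2 * ⌈(l : ℝ) / 2⌉ := by exact_mod_cast h1
      have h4 : 4 * ⌈(l : ℝ) / 2⌉ ≤ (r : ℤ) := by exact_mod_cast h2
      omega
    obtain ⟨A, _, L, _, D, ⟨χ, v, hv⟩, hD⟩ := exists_splitSystem hl0 hlm hmr G φ hφ
    have down : ∀ M : ℕ → ℕ, Monotone M → DehnLE (∀ i, G i) M →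
        ∃ C, DehnLE φ.ker (dyadic (affineUp M C)) := fun M hM h => by
      obtain ⟨C, hC⟩ := D.dehnLE_coabelian hM ((hD M hM).1.2 h)
      exact ⟨C, (hD _ (dyadic_mono fun _ _ h => affineUp_mono hM le_rfl h)).2.1 hC⟩
    have hfg : Group.FG (∀ b, A b) := ((hD _ hM₀).1.2 hGM₀).fg
    refine ⟨(down _ hM₀ hGM₀).choose_spec.isFinitelyPresented, fun P Q f hf0 hfm hfP => ?_⟩
    have hcl := superadditiveClosure_isLeast f
    have hcl0 : ∀ n, 0 ≤ superadditiveClosure f n := fun n => (hf0 n).trans (hcl.1.2 n)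
    have hlow : AsympLE f (fun n => (Q.dehn n : ℝ)) := by
      have h1 := D.dehnLE_pi χ hv Q.dehn_mono ((hD _ Q.dehn_mono).2.2 Q.dehnLE)
      exact hfP.1.trans (((hD _ Q.dehn_mono).1.1 h1).asympLE Q.dehn_mono P) (hcast Q)
        fun n => Nat.cast_nonneg _
    -- The product itself has at least quadratic Dehn function, so `f` absorbs the linear terms of
    -- `affineUp` before the dyadic summation.
    obtain ⟨C₀, hC₀⟩ := D.sq_le χ hv (j := MonoidHom.id _) Function.injective_id
      (fun x _ => ⟨x, rfl⟩) P.dehn_mono ((hD _ P.dehn_mono).1.2 P.dehnLE)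
    have hup : ∀ C, AsympLE (fun n => (affineUp P.dehn C n : ℝ)) f := fun C =>
      (asympLE_affineUp P.dehn_mono C).trans hfP.2 hfm hf0
    have hsq : AsympLE (fun n => (n : ℝ) ^ 2) f := by
      obtain ⟨E, hE, h⟩ := hup C₀
      exact ⟨E, hE, fun n => le_trans (by simpa using (Nat.cast_le (α := ℝ)).2 (hC₀ n)) (h n)⟩
    obtain ⟨C₁, -, hC₁⟩ := exists_le_of_sq_asympLE hf0 hfm hsq
    obtain ⟨C, hC⟩ := down _ P.dehn_mono P.dehnLE
    obtain ⟨B, hB, hT⟩ := (hup C).exists_le hf0 hfm hC₁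
    have hQ := hC.asympLE (dyadic_mono fun _ _ h => affineUp_mono P.dehn_mono le_rfl h) Q
    refine ⟨hlow, hQ.trans (dyadic_asympLE_log hcl.1.1 hcl0 hB fun n hn => (hT n hn).trans ?_)
      (log_mul_monotone hcl.1.1 hcl0)
      (fun n => mul_nonneg (Real.log_natCast_nonneg n) (hcl0 n)), fun hf => ⟨?_, hlow⟩⟩
    · exact mul_le_mul_of_nonneg_left (hcl.1.2 _) (Nat.cast_nonneg B)
    · exact hQ.trans (dyadic_asympLE_of_superadditive_div hf0 hfm hf hB hT) hfm hf0
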